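/- Let $\mathcal H$ be a separable complex Hilbert space of finite or infinite dimension. A density matrix is a positive trace class operator of trace $1$. For a non-negative compact operator $A$ on $\mathcal H$ let $\lambda_1(A)\ge\lambda_2(A)\ge\cdots\ge 0$ be its eigenvalues in non-increasing order, repeated according to multiplicity: $\lambda_j(A)$ is the $j$-th largest positive eigenvalue, and $\lambda_j(A)=0$ if there are fewer than $j$ of them. For non-increasing summable sequences of non-negative numbers with $\sum_j\kappa_j=\sum_j\lambda_j$, write $\{\kappa_j\}\prec\{\lambda_j\}$ if $\sum_{j=1}^k\kappa_j\le\sum_{j=1}^k\lambda_j$ for all $k\ge1$. **Theorem.** Let $\rho,\sigma$ be density matrices on $\mathcal H$, let $t\in[0,1]$, and let $$\rho\star_t\sigma=t\rho+(1-t)\sigma+i\sqrt{t(1-t)}\,(\rho\sigma-\sigma\rho).$$ Then $\rho\star_t\sigma$ is a density matrix, and $$\{\lambda_j(\rho\star_t\sigma)\}\prec\{t\lambda_j(\rho)+(1-t)\lambda_j(\sigma)\}.$$ If $t\in\{0,1\}$, the two sequences are equal. If $0<t<1$, they are equal if and only if there is an orthonormal family $\{\phi_j\}$ in $\mathcal H$,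 indexed by all $j\ge1$ with $j\le\dim\mathcal H$, such that $\rho\phi_j=\lambda_j(\rho)\phi_j$ and $\sigma\phi_j=\lambda_j(\sigma)\phi_j$ for each $j$, and such that $\rho$ and $\sigma$ vanish on the orthogonal complement of $\{\phi_j\}$. If moreover $\ker\rho\cap\ker\sigma=\{0\}$, or $\rho$ and $\sigma$ both have finite rank (in particular, if $\dim\mathcal H<\infty$), then for $0<t<1$ the two sequences are equal if and only if there is an orthonormal basis $\{\phi_j\}$ of $\mathcal H$, with the same index set, such that $\rho\phi_j=\lambda_j(\rho)\phi_j$ and $\sigma\phi_j=\lambda_j(\sigma)\phi_j$ for each $j$. -/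

import Mathlib

open scoped InnerProductSpace

noncomputable section

namespace PartialSwap

universe u

variable {H : Type u} [NormedAddCommGroup H] [InnerProductSpace ℂ H] [CompleteSpace H]

/-- A density matrix: a positive operator of trace one, the trace being the sum of the diagonal
matrix elements in every orthonormal (Hilbert) basis. -/
def IsDensity (ρ : H →L[ℂ] H) : Prop :=
  ρ.IsPositive ∧ ∀ (w : Set H) (b : HilbertBasis w ℂ H), HasSum (fun i => (⟪b i, ρ (b i)⟫_ℂ).re) 1

/-- `eigenvalueSeq A j`, `j = 0, 1, 2, …`, is the `(j + 1)`-st largest eigenvalue of the nonnegative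
compact operator `A`, eigenvalues being repeated according to multiplicity. The sequence continues
by `0` when there are no further positive eigenvalues. The space `⨆ ν ≥ μ, ker (A - ν)` has as its
dimension the number of eigenvalues `≥ μ`, counted with multiplicity, so the supremum is over
the positive eigenvalues `μ` for which that number is at least `j + 1`; it is `0` when there is
no such `μ`. -/
def eigenvalueSeq (A : H →L[ℂ] H) (j : ℕ) : ℝ :=
  sSup {μ : ℝ | 0 < μ ∧ Module.End.HasEigenvalue (A : H →ₗ[ℂ] H) (μ : ℂ) ∧
    (j : Cardinal.{u}) < Module.rank ℂ
      (⨆ (ν : ℝ) (_ : μ ≤ ν), Module.End.eigenspace (A : H →ₗ[ℂ] H) (ν : ℂ) : Submodule ℂ H)}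

/-- `star t ρ σ = t ρ + (1 - t) σ + i √(t (1 - t)) [ρ, σ]`. -/
def star (t : ℝ) (ρ σ : H →L[ℂ] H) : H →L[ℂ] H :=
  (t : ℂ) • ρ + ((1 - t : ℝ) : ℂ) • σ
    + (Complex.I * ((Real.sqrt (t * (1 - t)) : ℝ) : ℂ)) • (ρ * σ - σ * ρ)

/-- `IsMajorizedBy κ lam`: both are non-increasing summable sequences of nonnegative numbers with the
same sum, and each partial sum of `κ` is at most the corresponding partial sum of `lam`. -/
structure IsMajorizedBy (κ lam : ℕ → ℝ) : Prop where
  antitone_left : Antitone κ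
  antitone_right : Antitone lam
  nonneg_left : ∀ j, 0 ≤ κ j
  nonneg_right : ∀ j, 0 ≤ lam j
  summable_left : Summable κ
  summable_right : Summable lam
  tsum_eq : ∑' j, κ j = ∑' j, lam j
  sum_le : ∀ k : ℕ, ∑ j ∈ Finset.range k, κ j ≤ ∑ j ∈ Finset.range k, lam j

/-- The natural numbers `j < dim H`; all natural numbers when `H` is infinite dimensional. -/
abbrev DimIndex (H : Type u) [NormedAddCommGroup H] [InnerProductSpace ℂ H] : Type :=
  {j : ℕ // (j : Cardinal.{u}) < Module.rank ℂ H}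

/-- There is an orthonormal basis `φ_j` (`j < dim H`) of `H` with `ρ φ_j = λ_j(ρ) φ_j` and
`σ φ_j = λ_j(σ) φ_j` for every `j`. -/
def HasOrderedEigenbasis (ρ σ : H →L[ℂ] H) : Prop :=
  ∃ φ : HilbertBasis (DimIndex H) ℂ H, ∀ j : DimIndex H,
    ρ (φ j) = (eigenvalueSeq ρ j : ℂ) • φ j ∧ σ (φ j) = (eigenvalueSeq σ j : ℂ) • φ j

/-- There is an orthonormal family `φ_j` (`j < dim H`) in `H` with `ρ φ_j = λ_j(ρ) φ_j` and
`σ φ_j = λ_j(σ) φ_j` for every `j`, and `ρ` and `σ` vanish on the orthogonal complement of the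
family. Adding an orthonormal basis of that complement makes it a common orthonormal eigenbasis. -/
def HasOrderedEigensystem (ρ σ : H →L[ℂ] H) : Prop :=
  ∃ φ : DimIndex H → H, Orthonormal ℂ φ ∧
    (∀ j : DimIndex H,
      ρ (φ j) = (eigenvalueSeq ρ j : ℂ) • φ j ∧ σ (φ j) = (eigenvalueSeq σ j : ℂ) • φ j) ∧
    ∀ v : H, (∀ j : DimIndex H, ⟪φ j, v⟫_ℂ = 0) → ρ v = 0 ∧ σ v = 0

end PartialSwap

end

noncomputable section
set_option linter.unusedSectionVars false

namespace PartialSwap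

universe u

variable {H : Type u} [NormedAddCommGroup H] [InnerProductSpace ℂ H] [CompleteSpace H]

/-! ### Positive operators and traces of density matrices -/

section

section Positive

variable {A : H →L[ℂ] H}

/-! Let `P` project onto the span of the top `k` eigenvectors `u i` of `star t ρ σ`, and let `Q = 1
- P`. The trace of `star t ρ σ` over this span is `t tr(Pρ) + (1 - t) tr(Pσ)` plus a commutator
term. The diagonal blocks `PρP` and `PσP` contribute nothing to the commutator term, because a
commutator of finite matrices has trace zero. Only the blocks `QρP` and `QσP` remain, and AM-GM
bounds their contribution by `t ‖QρP‖² + (1 - t) ‖QσP‖²` in the Hilbert-Schmidt norm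
(`sum_re_inner_star_le`).

Majorization therefore follows from an estimate for a single density matrix `A`
(`IsDensity.sum_norm_residual_le`): `‖QAP‖²` is at most the sum of the `k` largest eigenvalues minus
`tr(PA)`. To prove it, write `A = c + D - B`, where `c` is the `k`-th eigenvalue, `D` carries the
excess of the first `k` eigenvalues over `c`, and `0 ≤ B ≤ c`. The scalar does not contribute to
`QAP`, and the right-hand side equals `x + z` with `x = tr(QD)` and `z = tr(PB)`. If `α` is the
largest entry of `D`, then `‖QDP‖² ≤ α x` and `‖QBP‖² ≤ c z`, so `‖QAP‖² ≤ (√(αx) + √(cz))² ≤ (α +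
c)(x + z)`, and `α + c` is the top eigenvalue, which is at most `1`.

The quadratic terms discarded in these bounds settle the equality case: equality forces `x = z = 0`.
For `0 < t < 1`, equality of the two sequences thus makes every span of initial eigenvectors of
`star t ρ σ` invariant under `ρ` and `σ` and optimal for their traces, so these vectors are ordered
eigenvectors of both.

The rest is the spectral theorem for density matrices, derived from the definition of the trace,
together with the passage from an eigensystem to a basis. -/

lemma norm_inner_sq_le_of_isPositive (hA : A.IsPositive) (v w : H) :
    ‖⟪w, A v⟫_ℂ‖ ^ 2 ≤ (⟪w, A w⟫_ℂ).re * (⟪v, A v⟫_ℂ).re := by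
  rw [← ContinuousLinearMap.nonneg_iff_isPositive] at hA
  obtain ⟨B, rfl⟩ := CStarAlgebra.nonneg_iff_eq_star_mul_self.mp hA
  have h (x y : H) : ⟪x, (Star.star B * B) y⟫_ℂ = ⟪B x, B y⟫_ℂ := by
    rw [mul_apply_eq_comp, ContinuousLinearMap.star_eq_adjoint,
      ContinuousLinearMap.adjoint_inner_right]
  have h2 (x : H) : (⟪B x, B x⟫_ℂ).re = ‖B x‖ ^ 2 := inner_self_eq_norm_sq (𝕜 := ℂ) (B x)
  rw [h, h, h, h2, h2, ← mul_pow]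
  exact pow_le_pow_left₀ (norm_nonneg _) (norm_inner_le_norm _ _) 2

lemma re_inner_nonneg (hA : A.IsPositive) (v : H) : 0 ≤ (⟪v, A v⟫_ℂ).re :=
  hA.re_inner_nonneg_right v

lemma im_inner_eq_zero (hA : A.IsPositive) (v : H) : (⟪v, A v⟫_ℂ).im = 0 := by
  have h := hA.inner_nonneg_right v
  rw [Complex.le_def] at h
  simpa using h.2.symm

lemma apply_eq_zero_of_re_inner_eq_zero (hA : A.IsPositive) {v : H} (h : (⟪v, A v⟫_ℂ).re = 0) :
    A v = 0 := by
  have := norm_inner_sq_le_of_isPositive hA v (A v)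
  rw [h, mul_zero] at this
  have h2 : ‖⟪A v, A v⟫_ℂ‖ = 0 := by
    have := norm_nonneg ⟪A v, A v⟫_ℂ
    nlinarith
  simpa using h2

/-- A positive operator bounded by `c` on an element and its image satisfies `A² ≤ c A` there. -/
lemma norm_apply_sq_le (hA : A.IsPositive) {c : ℝ} (v : H)
    (hc : (⟪A v, A (A v)⟫_ℂ).re ≤ c * ‖A v‖ ^ 2) : ‖A v‖ ^ 2 ≤ c * (⟪v, A v⟫_ℂ).re := by
  have h := norm_inner_sq_le_of_isPositive hA v (A v)
  have h1 : ‖⟪A v, A v⟫_ℂ‖ = ‖A v‖ ^ 2 := by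
    rw [inner_self_eq_norm_sq_to_K]; simp
  rw [h1] at h
  have h0 := re_inner_nonneg hA v
  by_cases hz : A v = 0
  · simp [hz]
  · have hp : 0 < ‖A v‖ ^ 2 := by positivity
    have : ‖A v‖ ^ 2 * ‖A v‖ ^ 2 ≤ ‖A v‖ ^ 2 * (c * (⟪v, A v⟫_ℂ).re) := by
      nlinarith [mul_le_mul_of_nonneg_right hc h0]
    exact le_of_mul_le_mul_left this hp

end Positive

/-- Every orthonormal family extends to a Hilbert basis. -/
lemma exists_hilbertBasis_extending {ι : Type*} {φ : ι → H} (hφ : Orthonormal ℂ φ) :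
    ∃ (w : Set H) (b : HilbertBasis w ℂ H) (f : ι → w), Function.Injective f ∧
      (∀ i, b (f i) = φ i) := by
  obtain ⟨w, b, hw, hb⟩ := (hφ.toSubtypeRange).exists_hilbertBasis_extension
  refine ⟨w, b, fun i => ⟨φ i, hw ⟨i, rfl⟩⟩, ?_, fun i => by rw [hb]⟩
  intro i j h
  exact hφ.linearIndependent.injective (congrArg Subtype.val h)

namespace IsDensity

variable {A : H →L[ℂ] H}

lemma summable (hA : IsDensity A) {ι : Type*} {φ : ι → H} (hφ : Orthonormal ℂ φ) :
    Summable fun i => (⟪φ i, A (φ i)⟫_ℂ).re := by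
  obtain ⟨w, b, f, hf, hb⟩ := exists_hilbertBasis_extending hφ
  have := (hA.2 w b).summable.comp_injective hf
  simpa [Function.comp_def, hb] using this

/-- The trace of a density matrix over any orthonormal family is at most one. -/
lemma tsum_le_one (hA : IsDensity A) {ι : Type*} {φ : ι → H} (hφ : Orthonormal ℂ φ) :
    ∑' i, (⟪φ i, A (φ i)⟫_ℂ).re ≤ 1 := by
  obtain ⟨w, b, f, hf, hb⟩ := exists_hilbertBasis_extending hφ
  rw [← (hA.2 w b).tsum_eq]
  exact (hA.summable hφ).tsum_le_tsum_of_inj f hf (fun c _ => re_inner_nonneg hA.1 _)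
    (fun i => by rw [hb]) (hA.2 w b).summable

lemma sum_le_one (hA : IsDensity A) {ι : Type*} {φ : ι → H} (hφ : Orthonormal ℂ φ)
    (s : Finset ι) : ∑ i ∈ s, (⟪φ i, A (φ i)⟫_ℂ).re ≤ 1 :=
  ((hA.summable hφ).sum_le_tsum s fun _ _ => re_inner_nonneg hA.1 _).trans (hA.tsum_le_one hφ)

/-- If an orthonormal family carries the whole trace then the density matrix vanishes on its
orthogonal complement. -/
lemma apply_eq_zero_of_hasSum (hA : IsDensity A) {ι : Type*} {φ : ι → H}
    (hφ : Orthonormal ℂ φ) (h : HasSum (fun i => (⟪φ i, A (φ i)⟫_ℂ).re) 1) {v : H}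
    (hv : ∀ i, ⟪φ i, v⟫_ℂ = 0) : A v = 0 := by
  classical
  by_contra hne
  have hv0 : v ≠ 0 := fun h => hne (by simp [h])
  have hn : ‖v‖ ≠ 0 := by simpa using hv0
  -- Adjoining the normalized `v` to the family would push the trace above `1` unless the form of
  -- `A` vanishes at `v`.
  let ψ : Option ι → H := fun o => o.elim (((‖v‖⁻¹ : ℝ) : ℂ) • v) φ
  have hψ : Orthonormal ℂ ψ := by
    constructor
    · rintro (_ | i)
      · simp [ψ, norm_smul, hn]
      · exact hφ.1 i
    · rintro (_ | i) (_ | j) hij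
      · exact absurd rfl hij
      · simp only [ψ, Option.elim, inner_smul_left]
        rw [← inner_conj_symm, hv]; simp
      · simp only [ψ, Option.elim, inner_smul_right, hv, mul_zero]
      · exact hφ.2 fun h => hij (by rw [h])
  have h1 : ∀ s : Finset ι, (⟪ψ none, A (ψ none)⟫_ℂ).re + ∑ i ∈ s, (⟪φ i, A (φ i)⟫_ℂ).re ≤ 1 := by
    intro s
    have := hA.sum_le_one hψ (Finset.insertNone s)
    rwa [Finset.sum_insertNone] at this
  have h2 : (⟪ψ none, A (ψ none)⟫_ℂ).re + 1 ≤ 1 :=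
    le_of_tendsto (h.const_add _) (Filter.Eventually.of_forall h1)
  have h3 : A (ψ none) = 0 :=
    apply_eq_zero_of_re_inner_eq_zero hA.1 (le_antisymm (by linarith) (re_inner_nonneg hA.1 _))
  simp only [ψ, Option.elim, map_smul, smul_eq_zero] at h3
  rcases h3 with h3 | h3
  · simp [hv0] at h3
  · exact hne h3

lemma hasSum_one_of_apply_eq_zero (hA : IsDensity A) {ι : Type*} {φ : ι → H}
    (hφ : Orthonormal ℂ φ) (h : ∀ v, (∀ i, ⟪φ i, v⟫_ℂ = 0) → A v = 0) :
    HasSum (fun i => (⟪φ i, A (φ i)⟫_ℂ).re) 1 := by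
  obtain ⟨w, b, f, hf, hb⟩ := exists_hilbertBasis_extending hφ
  have := (hf.hasSum_iff (f := fun i => (⟪b i, A (b i)⟫_ℂ).re) ?_).mpr (hA.2 w b)
  · simpa [Function.comp_def, hb] using this
  · intro x hx
    rw [h (b x)]
    · simp
    · intro i
      rw [← hb]
      exact b.orthonormal.2 fun h => hx ⟨i, h⟩

lemma re_inner_le (hA : IsDensity A) (v : H) : (⟪v, A v⟫_ℂ).re ≤ ‖v‖ ^ 2 := by
  by_cases hv : v = 0
  · simp [hv]
  have hn : ‖v‖ ≠ 0 := by simpa using hv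
  have ho : Orthonormal ℂ (fun _ : Unit => ((‖v‖⁻¹ : ℝ) : ℂ) • v) :=
    ⟨fun _ => by simp [norm_smul, hn], fun i j hij => absurd rfl hij⟩
  have := hA.sum_le_one ho Finset.univ
  simp only [Finset.univ_unique, Finset.sum_const, Finset.card_singleton, one_smul, map_smul,
    inner_smul_left, inner_smul_right, Complex.conj_ofReal, Complex.re_ofReal_mul] at this
  have h2 : 0 < ‖v‖ := by positivity
  calc (⟪v, A v⟫_ℂ).re = ‖v‖ ^ 2 * (‖v‖⁻¹ * (‖v‖⁻¹ * (⟪v, A v⟫_ℂ).re)) := by field_simp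
    _ ≤ ‖v‖ ^ 2 * 1 := by gcongr
    _ = _ := mul_one _

/-- This is `A² ≤ A`, which holds because trace one forces `A ≤ 1`. Positivity of `star t ρ σ` rests
on it, as does the Hilbert-Schmidt summability. -/
lemma norm_apply_sq_le_re_inner (hA : IsDensity A) (v : H) :
    ‖A v‖ ^ 2 ≤ (⟪v, A v⟫_ℂ).re := by
  have := norm_apply_sq_le hA.1 (c := 1) v (by rw [one_mul]; exact hA.re_inner_le _)
  linarith

lemma summable_norm_apply_sq (hA : IsDensity A) {w : Set H} (b : HilbertBasis w ℂ H) :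
    Summable fun i => ‖A (b i)‖ ^ 2 :=
  (hA.2 w b).summable.of_nonneg_of_le (fun _ => by positivity)
    fun i => hA.norm_apply_sq_le_re_inner _

end IsDensity

end

/-! ### Orthogonal residuals, compactness and top eigenvectors -/

section

section Residual

variable {ι : Type*} [Fintype ι] {u : ι → H}

/-- The component of `x` orthogonal to a finite orthonormal family `u`. -/
def residual (u : ι → H) (x : H) : H := x - ∑ i, ⟪u i, x⟫_ℂ • u i

lemma inner_residual (hu : Orthonormal ℂ u) (i : ι) (x : H) : ⟪u i, residual u x⟫_ℂ = 0 := by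
  rw [residual, inner_sub_right, hu.inner_right_fintype, sub_self]

lemma inner_residual_residual (hu : Orthonormal ℂ u) (x y : H) :
    ⟪residual u x, residual u y⟫_ℂ = ⟪x, y⟫_ℂ - ∑ i, ⟪x, u i⟫_ℂ * ⟪u i, y⟫_ℂ := by
  rw [residual, inner_sub_left, sum_inner]
  simp only [inner_smul_left, inner_residual hu, mul_zero, Finset.sum_const_zero, sub_zero]
  rw [residual, inner_sub_right, inner_sum]
  simp only [inner_smul_right, mul_comm]

lemma norm_residual_sq (hu : Orthonormal ℂ u) (x : H) :
    ‖residual u x‖ ^ 2 = ‖x‖ ^ 2 - ∑ i, ‖⟪u i, x⟫_ℂ‖ ^ 2 := by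
  have h := congrArg Complex.re (inner_residual_residual hu x x)
  have e (z : H) : (⟪z, z⟫_ℂ).re = ‖z‖ ^ 2 := inner_self_eq_norm_sq (𝕜 := ℂ) z
  rw [Complex.sub_re, e, e, Complex.re_sum] at h
  rw [h]
  congr 1
  refine Finset.sum_congr rfl fun i _ => ?_
  rw [← inner_conj_symm, Complex.conj_mul', ← Complex.ofReal_pow, Complex.ofReal_re]

lemma residual_add (x y : H) : residual u (x + y) = residual u x + residual u y := by
  simp only [residual, inner_add_right, add_smul, Finset.sum_add_distrib]; abel

lemma residual_smul (c : ℂ) (x : H) : residual u (c • x) = c • residual u x := by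
  simp only [residual, inner_smul_right, smul_sub, Finset.smul_sum, smul_smul]

lemma residual_sub (x y : H) : residual u (x - y) = residual u x - residual u y := by
  simp only [residual, inner_sub_right, sub_smul, Finset.sum_sub_distrib]; abel

lemma residual_sum {κ : Type*} (s : Finset κ) (x : κ → H) :
    residual u (∑ j ∈ s, x j) = ∑ j ∈ s, residual u (x j) := by
  simp only [residual, inner_sum, Finset.sum_smul, Finset.sum_sub_distrib]
  rw [Finset.sum_comm]

lemma residual_self (hu : Orthonormal ℂ u) (i : ι) : residual u (u i) = 0 := by
  classical
  simp only [residual, orthonormal_iff_ite.mp hu, ite_smul, one_smul, zero_smul]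
  simp

end Residual

variable {A : H →L[ℂ] H}

/-- Parseval's identity. -/
lemma hasSum_norm_inner_sq {w : Type*} (b : HilbertBasis w ℂ H) (x : H) :
    HasSum (fun i => ‖⟪b i, x⟫_ℂ‖ ^ 2) (‖x‖ ^ 2) := by
  have := Complex.hasSum_re (b.hasSum_inner_mul_inner x x)
  have e : (⟪x, x⟫_ℂ).re = ‖x‖ ^ 2 := inner_self_eq_norm_sq (𝕜 := ℂ) _
  rw [e] at this
  convert this using 2 with i
  rw [← inner_conj_symm x, Complex.conj_mul', ← Complex.ofReal_pow, Complex.ofReal_re]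

/-- The finite-rank truncations `T F`, that is `A` followed by projection onto finitely many basis
vectors, converge in norm: the square of the error is at most the tail of the Hilbert-Schmidt sum `∑
‖A (b i)‖²`. -/
lemma IsDensity.isCompactOperator (hA : IsDensity A) : IsCompactOperator A := by
  classical
  obtain ⟨w, b, -⟩ := exists_hilbertBasis ℂ H
  have hs := hA.summable_norm_apply_sq b
  let T : Finset w → H →L[ℂ] H := fun F =>
    ∑ i ∈ F, (ContinuousLinearMap.toSpanSingleton ℂ (b i)).comp ((innerSL ℂ (b i)).comp A)
  have hT : ∀ F, IsCompactOperator (T F) := by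
    intro F
    have : T F ∈ compactOperator (RingHom.id ℂ) H H := by
      refine Submodule.sum_mem _ fun i _ => ?_
      exact (isCompactOperator_of_locallyCompactSpace_rng
        (ContinuousLinearMap.toSpanSingleton ℂ (b i))).comp_clm ((innerSL ℂ (b i)).comp A)
    exact this
  have hTe : ∀ F x, A x - T F x = residual (fun i : F => b i) (A x) := by
    intro F x
    rw [residual, Finset.sum_coe_sort F (fun i => ⟪b i, A x⟫_ℂ • b i)]
    simp [T]
  have hb : ∀ F x, ‖(A - T F) x‖ ^ 2 ≤
      (∑' i, ‖A (b i)‖ ^ 2 - ∑ i ∈ F, ‖A (b i)‖ ^ 2) * ‖x‖ ^ 2 := by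
    intro F x
    have ho : Orthonormal ℂ (fun i : F => b i) := b.orthonormal.comp _ Subtype.val_injective
    have hP := hasSum_norm_inner_sq b (A x)
    have hd : ∀ i, ‖⟪b i, A x⟫_ℂ‖ ^ 2 ≤ ‖A (b i)‖ ^ 2 * ‖x‖ ^ 2 := by
      intro i
      rw [← hA.1.inner_left_eq_inner_right, ← mul_pow]
      exact pow_le_pow_left₀ (norm_nonneg _) (norm_inner_le_norm _ _) 2
    have h0 := Finset.sum_coe_sort F (fun i => ‖⟪b i, A x⟫_ℂ‖ ^ 2)
    rw [sub_apply, hTe, norm_residual_sq ho, h0, ← hP.tsum_eq, sub_mul,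
      ← tsum_mul_right, Finset.sum_mul, sub_le_sub_iff, ← sub_le_sub_iff]
    have e1 := hP.summable.sum_add_tsum_compl (s := F)
    have e2 := (hs.mul_right (‖x‖ ^ 2)).sum_add_tsum_compl (s := F)
    rw [← e1, ← e2]
    simp only [add_sub_cancel_left]
    exact (hP.summable.subtype _).tsum_le_tsum (fun i => hd i)
      ((hs.mul_right (‖x‖ ^ 2)).subtype _)
  refine isCompactOperator_of_tendsto (l := Filter.atTop) (F := T) ?_
    (Filter.Eventually.of_forall hT)
  rw [tendsto_iff_norm_sub_tendsto_zero]
  have hlim : Filter.Tendsto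
      (fun F : Finset w => √(∑' i, ‖A (b i)‖ ^ 2 - ∑ i ∈ F, ‖A (b i)‖ ^ 2))
      Filter.atTop (nhds 0) := by
    have := ((hs.hasSum.const_sub (∑' i, ‖A (b i)‖ ^ 2))).sqrt
    simpa using this
  refine squeeze_zero (fun _ => norm_nonneg _) (fun F => ?_) hlim
  rw [norm_sub_rev]
  refine ContinuousLinearMap.opNorm_le_bound _ (Real.sqrt_nonneg _) fun x => ?_
  have h0 : 0 ≤ ∑' i, ‖A (b i)‖ ^ 2 - ∑ i ∈ F, ‖A (b i)‖ ^ 2 :=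
    sub_nonneg.mpr (hs.sum_le_tsum _ fun _ _ => by positivity)
  refine abs_le_of_sq_le_sq' ?_ (by positivity) |>.2
  rw [mul_pow, Real.sq_sqrt h0]
  exact hb F x

/-- On a nontrivial closed invariant subspace the quadratic form of a positive compact operator
attains its maximum over the unit sphere. -/
lemma exists_isMax_of_isCompactOperator (hA : A.IsPositive) (hc : IsCompactOperator A)
    {W : Submodule ℂ H} (hW : IsClosed (W : Set H)) (hinv : ∀ v ∈ W, A v ∈ W) (hne : W ≠ ⊥) :
    ∃ p ∈ W, ‖p‖ = 1 ∧ ∀ v ∈ W, (⟪v, A v⟫_ℂ).re ≤ (⟪p, A p⟫_ℂ).re * ‖v‖ ^ 2 := by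
  set R : Set ℝ := (fun v => (⟪v, A v⟫_ℂ).re) '' {v | v ∈ W ∧ ‖v‖ = 1} with hR
  have hunit : ∀ v ∈ W, v ≠ 0 → ((‖v‖⁻¹ : ℝ) : ℂ) • v ∈ {v | v ∈ W ∧ ‖v‖ = 1} := by
    intro v hv h0
    exact ⟨W.smul_mem _ hv, by simp [norm_smul, h0]⟩
  obtain ⟨v₀, hv₀, hv₀n⟩ := W.exists_mem_ne_zero_of_ne_bot hne
  have hRne : R.Nonempty := ⟨_, _, hunit v₀ hv₀ hv₀n, rfl⟩
  have hRb : BddAbove R := by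
    refine ⟨‖A‖, ?_⟩
    rintro _ ⟨v, ⟨-, hv⟩, rfl⟩
    calc (⟪v, A v⟫_ℂ).re ≤ ‖⟪v, A v⟫_ℂ‖ := Complex.re_le_norm _
      _ ≤ ‖v‖ * ‖A v‖ := norm_inner_le_norm _ _
      _ ≤ 1 * (‖A‖ * 1) := by
        rw [hv]; gcongr; simpa [hv] using A.le_opNorm v
      _ = ‖A‖ := by ring
  set M := sSup R with hM
  have hle : ∀ v ∈ W, (⟪v, A v⟫_ℂ).re ≤ M * ‖v‖ ^ 2 := by
    intro v hv
    by_cases h0 : v = 0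
    · simp [h0]
    have h := le_csSup hRb ⟨_, hunit v hv h0, rfl⟩
    simp only [map_smul, inner_smul_left, inner_smul_right, Complex.conj_ofReal,
      Complex.re_ofReal_mul] at h
    have hn : 0 < ‖v‖ := norm_pos_iff.mpr h0
    calc (⟪v, A v⟫_ℂ).re = (‖v‖⁻¹ * (‖v‖⁻¹ * (⟪v, A v⟫_ℂ).re)) * ‖v‖ ^ 2 := by field_simp
      _ ≤ M * ‖v‖ ^ 2 := by gcongr
  suffices ∃ p ∈ W, ‖p‖ = 1 ∧ (⟪p, A p⟫_ℂ).re = M by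
    obtain ⟨p, hp, hp1, hpM⟩ := this
    exact ⟨p, hp, hp1, by rwa [hpM]⟩
  have hM0 : 0 ≤ M := by
    obtain ⟨r, v, hv, rfl⟩ := hRne
    exact (re_inner_nonneg hA v).trans (le_csSup hRb ⟨v, hv, rfl⟩)
  -- If `M = 0` the form vanishes on `W`, so any unit vector attains the maximum.
  rcases hM0.eq_or_lt with hM0 | hM0
  · refine ⟨_, (hunit v₀ hv₀ hv₀n).1, (hunit v₀ hv₀ hv₀n).2, le_antisymm ?_ ?_⟩
    · exact le_csSup hRb ⟨_, hunit v₀ hv₀ hv₀n, rfl⟩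
    · rw [← hM0]; exact re_inner_nonneg hA _
  obtain ⟨q, -, hq, hqR⟩ := exists_seq_tendsto_sSup hRne hRb
  choose v hvW hvq using hqR
  have hcpt := hc.isCompact_closure_image_closedBall (1 : ℝ)
  obtain ⟨y, -, φ, hφ, hy⟩ := hcpt.tendsto_subseq (x := fun n => A (v n)) fun n =>
    subset_closure ⟨v n, by simp [(hvW n).2], rfl⟩
  have hq' : Filter.Tendsto (fun n => q (φ n)) Filter.atTop (nhds M) := hq.comp hφ.tendsto_atTop
  -- A maximizing sequence is asymptotically an eigenvector: `‖Av‖² ≤ M ⟪v, Av⟫` gives `‖Mv - Av‖² ≤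
  -- M² - M ⟪v, Av⟫`. Since `Av` converges along a subsequence and `M ≠ 0`, `v` itself converges.
  have hr : Filter.Tendsto (fun n => (M : ℂ) • v (φ n) - A (v (φ n))) Filter.atTop (nhds 0) := by
    rw [tendsto_zero_iff_norm_tendsto_zero]
    have hb : ∀ n, ‖(M : ℂ) • v (φ n) - A (v (φ n))‖ ≤ √(M * M - M * q (φ n)) := by
      intro n
      apply Real.le_sqrt_of_sq_le
      have h1 := norm_apply_sq_le hA (v (φ n)) (hle _ (hinv _ (hvW (φ n)).1))
      have h2 : (⟪v (φ n), A (v (φ n))⟫_ℂ).re = q (φ n) := hvq _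
      rw [@norm_sub_sq ℂ, norm_smul, (hvW (φ n)).2, inner_smul_left, Complex.conj_ofReal]
      simp only [RCLike.re_to_complex, Complex.re_ofReal_mul, h2] at h1 ⊢
      rw [Complex.norm_of_nonneg hM0.le]
      nlinarith
    have hlim : Filter.Tendsto (fun n => √(M * M - M * q (φ n))) Filter.atTop (nhds 0) := by
      have := ((hq'.const_mul M).const_sub (M * M)).sqrt
      simpa using this
    exact squeeze_zero (fun _ => norm_nonneg _) hb hlim
  have hMC : (M : ℂ) ≠ 0 := by exact_mod_cast hM0.ne'
  have hv : Filter.Tendsto (fun n => v (φ n)) Filter.atTop (nhds ((M : ℂ)⁻¹ • (0 + y))) := by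
    have := (hr.add hy).const_smul ((M : ℂ)⁻¹)
    refine this.congr fun n => ?_
    rw [Function.comp_apply, sub_add_cancel, smul_smul, inv_mul_cancel₀ hMC, one_smul]
  set p := (M : ℂ)⁻¹ • (0 + y)
  refine ⟨p, hW.mem_of_tendsto hv (Filter.Eventually.of_forall fun n => (hvW _).1), ?_, ?_⟩
  · exact tendsto_nhds_unique (hv.norm.congr fun n => (hvW _).2) tendsto_const_nhds
  · have h1 : Filter.Tendsto (fun n => (⟪v (φ n), A (v (φ n))⟫_ℂ).re) Filter.atTop
        (nhds (⟪p, A p⟫_ℂ).re) :=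
      (Complex.continuous_re.tendsto _).comp (hv.inner ((A.continuous.tendsto _).comp hv))
    exact tendsto_nhds_unique (h1.congr fun n => hvq _) hq'

/-- A top eigenvector of a positive compact operator on the orthogonal complement of an
invariant subspace; it is `0` if that complement is trivial. -/
lemma exists_top_eigenvector (hA : A.IsPositive) (hc : IsCompactOperator A)
    (S : Submodule ℂ H) (hS : ∀ v ∈ S, A v ∈ S) :
    ∃ p ∈ Sᗮ, A p = ((⟪p, A p⟫_ℂ).re : ℂ) • p ∧ (Sᗮ ≠ ⊥ → ‖p‖ = 1) ∧
      ∀ v ∈ Sᗮ, (⟪v, A v⟫_ℂ).re ≤ (⟪p, A p⟫_ℂ).re * ‖v‖ ^ 2 := by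
  by_cases hne : Sᗮ = ⊥
  · refine ⟨0, Submodule.zero_mem _, by simp, fun h => absurd hne h, fun v hv => ?_⟩
    rw [hne, Submodule.mem_bot] at hv
    simp [hv]
  have hinv : ∀ v ∈ Sᗮ, A v ∈ Sᗮ := by
    intro v hv
    rw [Submodule.mem_orthogonal] at hv ⊢
    intro s hs
    rw [← hA.inner_left_eq_inner_right]
    exact hv _ (hS s hs)
  obtain ⟨p, hp, hp1, hmax⟩ :=
    exists_isMax_of_isCompactOperator hA hc S.isClosed_orthogonal hinv hne
  refine ⟨p, hp, ?_, fun _ => hp1, hmax⟩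
  have h1 := norm_apply_sq_le hA p (hmax _ (hinv _ hp))
  have h0 := re_inner_nonneg hA p
  -- The same expansion of the square, now at an exact maximizer.
  have h2 : ‖((⟪p, A p⟫_ℂ).re : ℂ) • p - A p‖ ^ 2 ≤ 0 := by
    rw [@norm_sub_sq ℂ, norm_smul, hp1, inner_smul_left, Complex.conj_ofReal]
    simp only [RCLike.re_to_complex, Complex.re_ofReal_mul]
    rw [Complex.norm_of_nonneg h0]
    nlinarith
  have h3 : ‖((⟪p, A p⟫_ℂ).re : ℂ) • p - A p‖ = 0 := by
    have := norm_nonneg (((⟪p, A p⟫_ℂ).re : ℂ) • p - A p)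
    nlinarith
  exact (sub_eq_zero.mp (norm_eq_zero.mp h3)).symm

end

/-! ### The eigenvalue sequence and the spectral theorem -/

section

variable {A : H →L[ℂ] H}

lemma mem_orthogonal_span_range {ι : Type*} {φ : ι → H} {v : H} :
    v ∈ (Submodule.span ℂ (Set.range φ))ᗮ ↔ ∀ i, ⟪φ i, v⟫_ℂ = 0 := by
  refine ⟨fun h i => h _ (Submodule.subset_span ⟨i, rfl⟩), fun h w hw => ?_⟩
  have : Submodule.span ℂ (Set.range φ) ≤ (ℂ ∙ v)ᗮ := by
    rw [Submodule.span_le]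
    rintro _ ⟨i, rfl⟩
    exact Submodule.mem_orthogonal_singleton_iff_inner_left.mpr (h i)
  exact Submodule.mem_orthogonal_singleton_iff_inner_left.mp (this hw)

lemma eq_zero_of_inner_dimIndex_eq_zero (hfin : Module.rank ℂ H < Cardinal.aleph0)
    {φ : DimIndex H → H} (hφ : Orthonormal ℂ φ) {v : H} (hv : ∀ j, ⟪φ j, v⟫_ℂ = 0) : v = 0 := by
  have : FiniteDimensional ℂ H := Module.rank_lt_aleph0_iff.mp hfin
  let e : DimIndex H ≃ Fin (Module.finrank ℂ H) :=
    (Equiv.subtypeEquivRight fun j => by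
      rw [← Module.finrank_eq_rank, Nat.cast_lt]).trans Fin.equivSubtype.symm
  have ho : Orthonormal ℂ (φ ∘ e.symm) := hφ.comp _ e.symm.injective
  have hs : Submodule.span ℂ (Set.range (φ ∘ e.symm)) = ⊤ :=
    ho.linearIndependent.span_eq_top_of_card_eq_finrank' (by simp)
  have hmem : v ∈ (Submodule.span ℂ (Set.range (φ ∘ e.symm)))ᗮ :=
    mem_orthogonal_span_range.mpr fun _ => hv _
  rw [hs, Submodule.top_orthogonal_eq_bot] at hmem
  simpa using hmem

/-- The eigenvalue sequence of a positive operator can be read off any orthonormal system of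
eigenvectors with non-increasing eigenvalues off which the operator vanishes. -/
lemma eigenvalueSeq_eq (hA : A.IsPositive) {φ : DimIndex H → H} (hφ : Orthonormal ℂ φ)
    {μ : ℕ → ℝ} (hanti : Antitone μ) (hnonneg : ∀ j, 0 ≤ μ j)
    (heig : ∀ j : DimIndex H, A (φ j) = (μ j : ℂ) • φ j)
    (hzero : ∀ v, (∀ j, ⟪φ j, v⟫_ℂ = 0) → A v = 0)
    (hdim : ∀ j : ℕ, Module.rank ℂ H ≤ j → μ j = 0) (j : ℕ) :
    eigenvalueSeq A j = μ j := by
  classical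
  let ψ : ℕ → H := fun i => if h : (i : Cardinal.{u}) < Module.rank ℂ H then φ ⟨i, h⟩ else 0
  have hψ : ∀ i : DimIndex H, ψ i = φ i := fun i => by simp only [ψ, dif_pos i.2, Subtype.coe_eta]
  have hψeig : ∀ i, A (ψ i) = (μ i : ℂ) • ψ i := by
    intro i
    by_cases h : (i : Cardinal.{u}) < Module.rank ℂ H
    · exact (hψ ⟨i, h⟩) ▸ heig ⟨i, h⟩
    · simp only [ψ, dif_neg h, map_zero, smul_zero]
  have hψo : ∀ (i : DimIndex H) (l : ℕ), ⟪φ i, ψ l⟫_ℂ = if (i : ℕ) = l then 1 else 0 := by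
    intro i l
    by_cases h : (l : Cardinal.{u}) < Module.rank ℂ H
    · have := orthonormal_iff_ite.mp hφ i ⟨l, h⟩
      rw [← hψ ⟨l, h⟩] at this
      rw [this]
      simp only [Subtype.ext_iff]
    · have hne : (i : ℕ) ≠ l := fun hil => h (hil ▸ i.2)
      simp only [ψ, dif_neg h, inner_zero_right, if_neg hne]
  have horth : ∀ (ν : ℝ) (v : H), A v = (ν : ℂ) • v → ∀ i, μ i ≠ ν → ⟪ψ i, v⟫_ℂ = 0 := by
    intro ν v hv i hi
    have h1 := hA.inner_left_eq_inner_right (ψ i) v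
    rw [hψeig, hv, inner_smul_left, inner_smul_right, Complex.conj_ofReal] at h1
    have h2 : ((μ i : ℂ) - ν) * ⟪ψ i, v⟫_ℂ = 0 := by rw [sub_mul, h1, sub_self]
    exact (mul_eq_zero.mp h2).resolve_left (sub_ne_zero.mpr (by exact_mod_cast hi))
  -- If `μ j < m`, every eigenvector with eigenvalue `ν ≥ m` lies in the span of `ψ 0, …, ψ (j -
  -- 1)`: its remainder is both killed by `A` and an eigenvector for `ν ≠ 0`. The eigenspaces then
  -- span a space of dimension at most `j`.
  have hupper : ∀ m : ℝ, 0 < m → (j : Cardinal.{u}) < Module.rank ℂ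
      (⨆ (ν : ℝ) (_ : m ≤ ν), Module.End.eigenspace (A : H →ₗ[ℂ] H) (ν : ℂ) : Submodule ℂ H) →
      m ≤ μ j := by
    intro m hm hlt
    by_contra! hj
    have hsub : (⨆ (ν : ℝ) (_ : m ≤ ν), Module.End.eigenspace (A : H →ₗ[ℂ] H) (ν : ℂ)) ≤
        Submodule.span ℂ ((Finset.image ψ (Finset.range j) : Finset H) : Set H) := by
      refine iSup₂_le fun ν hν v hv => ?_
      have hv : A v = (ν : ℂ) • v := Module.End.mem_eigenspace_iff.mp hv
      have hν0 : (ν : ℂ) ≠ 0 := by exact_mod_cast (hm.trans_le hν).ne'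
      have hw : A (v - ∑ i ∈ Finset.range j, ⟪ψ i, v⟫_ℂ • ψ i) = 0 := by
        apply hzero
        intro i
        rw [inner_sub_right, inner_sum]
        simp only [inner_smul_right, hψo, mul_ite, mul_one, mul_zero]
        by_cases hij : (i : ℕ) < j
        · rw [Finset.sum_ite_eq, if_pos (Finset.mem_range.mpr hij), hψ, sub_self]
        · rw [Finset.sum_ite_eq, if_neg (by simpa using hij), sub_zero, ← hψ]
          exact horth ν v hv i (((hanti (not_lt.mp hij)).trans_lt (hj.trans_le hν)).ne)
      have hw' : A (v - ∑ i ∈ Finset.range j, ⟪ψ i, v⟫_ℂ • ψ i) =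
          (ν : ℂ) • (v - ∑ i ∈ Finset.range j, ⟪ψ i, v⟫_ℂ • ψ i) := by
        rw [map_sub, hv, smul_sub, map_sum, Finset.smul_sum]
        congr 1
        refine Finset.sum_congr rfl fun i _ => ?_
        rw [map_smul, hψeig]
        by_cases hi : μ i = ν
        · rw [hi, smul_comm]
        · rw [horth ν v hv i hi]; simp
      rw [hw'] at hw
      have hw := sub_eq_zero.mp ((smul_eq_zero.mp hw).resolve_left hν0)
      rw [hw]
      refine Submodule.sum_mem _ fun i hi => Submodule.smul_mem _ _ (Submodule.subset_span ?_)
      exact Finset.mem_coe.mpr (Finset.mem_image_of_mem _ hi)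
    have h1 := (Submodule.rank_mono hsub).trans (rank_span_finset_le _)
    have h2 : ((Finset.image ψ (Finset.range j)).card : Cardinal.{u}) ≤ (j : Cardinal.{u}) := by
      exact_mod_cast Finset.card_image_le.trans (Finset.card_range j).le
    exact absurd hlt (not_lt.mpr (h1.trans h2))
  rcases (hnonneg j).eq_or_lt with h0 | h0
  -- When `μ j = 0` no positive `m` qualifies, and the supremum of the empty set is `0` by
  -- convention.
  · rw [eigenvalueSeq, ← h0]
    convert Real.sSup_empty
    rw [Set.eq_empty_iff_forall_notMem]
    rintro m ⟨hm, -, hlt⟩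
    exact absurd (hupper m hm hlt) (by rw [← h0]; exact not_le.mpr hm)
  · have hj : (j : Cardinal.{u}) < Module.rank ℂ H := by
      by_contra h
      exact h0.ne' (hdim j (not_lt.mp h))
    have hg : IsGreatest {m : ℝ | 0 < m ∧ Module.End.HasEigenvalue (A : H →ₗ[ℂ] H) (m : ℂ) ∧
        (j : Cardinal.{u}) < Module.rank ℂ
          (⨆ (ν : ℝ) (_ : m ≤ ν), Module.End.eigenspace (A : H →ₗ[ℂ] H) (ν : ℂ) :
            Submodule ℂ H)} (μ j) := by
      refine ⟨⟨h0, ?_, ?_⟩, fun m hm => hupper m hm.1 hm.2.2⟩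
      · exact Module.End.hasEigenvalue_of_hasEigenvector (x := φ ⟨j, hj⟩)
          ⟨Module.End.mem_eigenspace_iff.mpr (heig ⟨j, hj⟩), hφ.ne_zero _⟩
      · let g : Fin (j + 1) → DimIndex H := fun i =>
          ⟨i, lt_of_le_of_lt (by exact_mod_cast Nat.lt_succ_iff.mp i.2) hj⟩
        have hg : Function.Injective g := fun a b hab => Fin.ext (congrArg Subtype.val hab)
        have hmem : ∀ i, φ (g i) ∈ (⨆ (ν : ℝ) (_ : μ j ≤ ν),
            Module.End.eigenspace (A : H →ₗ[ℂ] H) (ν : ℂ) : Submodule ℂ H) := by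
          intro i
          refine Submodule.mem_iSup_of_mem (μ i) (Submodule.mem_iSup_of_mem
            (hanti (Nat.lt_succ_iff.mp i.2)) ?_)
          exact Module.End.mem_eigenspace_iff.mpr (heig (g i))
        have hli : LinearIndependent ℂ (fun i => (⟨φ (g i), hmem i⟩ : (⨆ (ν : ℝ) (_ : μ j ≤ ν),
            Module.End.eigenspace (A : H →ₗ[ℂ] H) (ν : ℂ) : Submodule ℂ H))) :=
          LinearIndependent.of_comp (Submodule.subtype _) (hφ.comp g hg).linearIndependent
        have := hli.cardinal_lift_le_rank
        rw [Cardinal.mk_fin, Cardinal.lift_natCast, Cardinal.lift_uzero] at this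
        refine lt_of_lt_of_le ?_ this
        exact_mod_cast Nat.lt_succ_self j
    exact hg.csSup_eq

/-- Every density matrix has an orthonormal system of eigenvectors, ordered by eigenvalues, off
which it vanishes. -/
lemma IsDensity.exists_eigensystem_aux (hA : IsDensity A) :
    ∃ (φ : DimIndex H → H) (μ : ℕ → ℝ), Orthonormal ℂ φ ∧ Antitone μ ∧ (∀ j, 0 ≤ μ j) ∧
      (∀ j : DimIndex H, A (φ j) = (μ j : ℂ) • φ j) ∧
      (∀ v, (∀ j, ⟪φ j, v⟫_ℂ = 0) → A v = 0) ∧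
      (∀ j : ℕ, Module.rank ℂ H ≤ j → μ j = 0) ∧
      (∀ (j : DimIndex H) (v : H), (∀ i : DimIndex H, (i : ℕ) < j → ⟪φ i, v⟫_ℂ = 0) →
        (⟪v, A v⟫_ℂ).re ≤ μ j * ‖v‖ ^ 2) := by
  classical
  choose! p hpm hpe hpn hpx using
    fun S => exists_top_eigenvector (S := S) hA.1 hA.isCompactOperator
  -- `S n` is spanned by the first `n` vectors chosen, each a top eigenvector on the orthogonal
  -- complement of its predecessors. The choice is `0` once the space is exhausted.
  obtain ⟨S, hS0, hSs⟩ : ∃ S : ℕ → Submodule ℂ H, S 0 = ⊥ ∧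
      ∀ n, S (n + 1) = S n ⊔ Submodule.span ℂ {p (S n)} :=
    ⟨fun n => Nat.rec ⊥ (fun _ T => T ⊔ Submodule.span ℂ {p T}) n, rfl, fun _ => rfl⟩
  have hinv : ∀ n, ∀ v ∈ S n, A v ∈ S n := by
    intro n
    induction n with
    | zero =>
      intro v hv
      rw [hS0] at hv ⊢
      rw [(Submodule.mem_bot ℂ).mp hv, map_zero]
      exact Submodule.zero_mem _
    | succ n ih =>
      intro v hv
      rw [hSs] at hv ⊢
      obtain ⟨x, hx, y, hy, rfl⟩ := Submodule.mem_sup.mp hv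
      obtain ⟨c, rfl⟩ := Submodule.mem_span_singleton.mp hy
      rw [map_add, map_smul, hpe (S n) ih]
      exact Submodule.add_mem_sup (ih x hx) (Submodule.smul_mem _ _ (Submodule.smul_mem _ _
        (Submodule.mem_span_singleton_self _)))
  have hmono : Monotone S := monotone_nat_of_le_succ fun n => by rw [hSs]; exact le_sup_left
  have hpS : ∀ n, p (S n) ∈ S (n + 1) := fun n => by
    rw [hSs]; exact Submodule.mem_sup_right (Submodule.mem_span_singleton_self _)
  have hrank : ∀ n : ℕ, Module.rank ℂ (S n) ≤ n := by
    intro n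
    induction n with
    | zero =>
      rw [hS0, rank_bot]; simp
    | succ n ih =>
      rw [hSs]
      refine (Submodule.rank_add_le_rank_add_rank _ _).trans ?_
      rw [Nat.cast_succ]
      refine add_le_add ih ((rank_span_le _).trans ?_)
      rw [Cardinal.mk_singleton]
  have hnorm : ∀ n : ℕ, (n : Cardinal.{u}) < Module.rank ℂ H → ‖p (S n)‖ = 1 := by
    intro n hn
    refine hpn (S n) (hinv n) fun hbot => ?_
    have : FiniteDimensional ℂ (S n) :=
      Module.rank_lt_aleph0_iff.mp ((hrank n).trans_lt (Cardinal.natCast_lt_aleph0))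
    have htop := (Submodule.orthogonal_eq_bot_iff).mp hbot
    have h := hrank n
    rw [htop, rank_top] at h
    exact absurd hn (not_lt.mpr h)
  let q : ℕ → ℝ := fun n => (⟪p (S n), A (p (S n))⟫_ℂ).re
  have hq : ∀ n, q n = (⟪p (S n), A (p (S n))⟫_ℂ).re := fun _ => rfl
  let μ : ℕ → ℝ := fun n => if (n : Cardinal.{u}) < Module.rank ℂ H then q n else 0
  have hμ : ∀ j : DimIndex H, μ j = q j := fun j => if_pos j.2
  let φ : DimIndex H → H := fun j => p (S j)
  have hlt : ∀ i j : ℕ, i < j → ⟪p (S i), p (S j)⟫_ℂ = 0 := by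
    intro i j hij
    exact (hpm (S j) (hinv j)) _ (hmono hij (hpS i))
  have hφ : Orthonormal ℂ φ := by
    refine ⟨fun j => hnorm j j.2, fun i j hij => ?_⟩
    rcases lt_or_gt_of_ne (fun h => hij (Subtype.ext h) : (i : ℕ) ≠ j) with h | h
    · exact hlt _ _ h
    · exact inner_eq_zero_symm.mp (hlt _ _ h)
  have hnonneg : ∀ j, 0 ≤ μ j := by
    intro j
    simp only [μ]
    split_ifs
    · exact re_inner_nonneg hA.1 _
    · exact le_rfl
  have hmax : ∀ (j : DimIndex H) (v : H), (∀ i : DimIndex H, (i : ℕ) < j → ⟪φ i, v⟫_ℂ = 0) →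
      (⟪v, A v⟫_ℂ).re ≤ μ j * ‖v‖ ^ 2 := by
    intro j v hv
    rw [hμ]
    refine hpx (S j) (hinv j) v ?_
    have key : ∀ n ≤ (j : ℕ), v ∈ (S n)ᗮ := by
      intro n
      induction n with
      | zero =>
        intro _
        rw [hS0, Submodule.bot_orthogonal_eq_top]; trivial
      | succ n ih =>
        intro hn
        rw [hSs, ← Submodule.inf_orthogonal]
        refine ⟨ih (by omega), ?_⟩
        rw [SetLike.mem_coe, Submodule.mem_orthogonal_singleton_iff_inner_right]
        exact hv ⟨n, lt_of_le_of_lt (by exact_mod_cast (Nat.le_of_succ_le hn)) j.2⟩ hn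
    exact key j le_rfl
  have hanti : Antitone μ := by
    refine antitone_nat_of_succ_le fun n => ?_
    by_cases h : ((n + 1 : ℕ) : Cardinal.{u}) < Module.rank ℂ H
    · have hn : (n : Cardinal.{u}) < Module.rank ℂ H :=
        lt_of_le_of_lt (by exact_mod_cast n.le_succ) h
      have h1 := hmax ⟨n, hn⟩ (p (S (n + 1))) fun i hi => hlt _ _ (hi.trans n.lt_succ_self)
      rw [hnorm _ h] at h1
      simpa [hμ ⟨n + 1, h⟩, hq] using h1
    · have : μ (n + 1) = 0 := if_neg h
      rw [this]
      exact hnonneg n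
  refine ⟨φ, μ, hφ, hanti, hnonneg, fun j => ?_, fun v hv => ?_,
    fun j hj => if_neg (not_lt.mpr hj), hmax⟩
  · rw [hμ]; exact hpe (S j) (hinv j)
  · rcases lt_or_ge (Module.rank ℂ H) Cardinal.aleph0 with hfin | hinf
    · rw [eq_zero_of_inner_dimIndex_eq_zero hfin hφ hv, map_zero]
    · have hall : ∀ n : ℕ, (n : Cardinal.{u}) < Module.rank ℂ H :=
        fun n => (Cardinal.natCast_lt_aleph0).trans_le hinf
      -- The eigenvalues are summable by the trace condition, hence tend to `0`, while each `q n`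
      -- bounds the form at `v`.
      have hlim : Filter.Tendsto (fun n : ℕ => q n * ‖v‖ ^ 2) Filter.atTop (nhds 0) := by
        have h1 := (hA.summable (hφ.comp (fun n : ℕ => (⟨n, hall n⟩ : DimIndex H))
          fun a b h => congrArg Subtype.val h)).tendsto_atTop_zero
        simpa using h1.mul_const (‖v‖ ^ 2)
      refine apply_eq_zero_of_re_inner_eq_zero hA.1
        (le_antisymm (ge_of_tendsto hlim (Filter.Eventually.of_forall fun n => ?_))
          (re_inner_nonneg hA.1 _))
      rw [← hμ ⟨n, hall n⟩]
      exact hmax ⟨n, hall n⟩ v fun i _ => hv i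

namespace IsDensity

lemma exists_eigensystem (hA : IsDensity A) :
    ∃ φ : DimIndex H → H, Orthonormal ℂ φ ∧
      (∀ j : DimIndex H, A (φ j) = (eigenvalueSeq A j : ℂ) • φ j) ∧
      (∀ v, (∀ j, ⟪φ j, v⟫_ℂ = 0) → A v = 0) ∧
      (∀ (j : DimIndex H) (v : H), (∀ i : DimIndex H, (i : ℕ) < j → ⟪φ i, v⟫_ℂ = 0) →
        (⟪v, A v⟫_ℂ).re ≤ eigenvalueSeq A j * ‖v‖ ^ 2) := by
  obtain ⟨φ, μ, hφ, hanti, hnonneg, heig, hzero, hdim, hmax⟩ := hA.exists_eigensystem_aux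
  have h := eigenvalueSeq_eq hA.1 hφ hanti hnonneg heig hzero hdim
  refine ⟨φ, hφ, fun j => ?_, hzero, fun j => ?_⟩
  · rw [h]; exact heig j
  · rw [h]; exact hmax j

lemma eigenvalueSeq_eq_zero (hA : IsDensity A) {j : ℕ} (hj : Module.rank ℂ H ≤ j) :
    eigenvalueSeq A j = 0 := by
  obtain ⟨φ, μ, hφ, hanti, hnonneg, heig, hzero, hdim, hmax⟩ := hA.exists_eigensystem_aux
  rw [eigenvalueSeq_eq hA.1 hφ hanti hnonneg heig hzero hdim, hdim j hj]

lemma antitone_eigenvalueSeq (hA : IsDensity A) : Antitone (eigenvalueSeq A) := by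
  obtain ⟨φ, μ, hφ, hanti, hnonneg, heig, hzero, hdim, hmax⟩ := hA.exists_eigensystem_aux
  rwa [funext (eigenvalueSeq_eq hA.1 hφ hanti hnonneg heig hzero hdim)]

lemma eigenvalueSeq_nonneg (hA : IsDensity A) (j : ℕ) : 0 ≤ eigenvalueSeq A j := by
  obtain ⟨φ, μ, hφ, hanti, hnonneg, heig, hzero, hdim, hmax⟩ := hA.exists_eigensystem_aux
  rw [eigenvalueSeq_eq hA.1 hφ hanti hnonneg heig hzero hdim]
  exact hnonneg j

lemma hasSum_eigenvalueSeq_dimIndex (hA : IsDensity A) :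
    HasSum (fun j : DimIndex H => eigenvalueSeq A j) 1 := by
  obtain ⟨φ, hφ, heig, hzero, -⟩ := hA.exists_eigensystem
  have := hA.hasSum_one_of_apply_eq_zero hφ hzero
  simpa [heig, inner_smul_right, inner_self_eq_norm_sq_to_K, hφ.1] using this

lemma hasSum_eigenvalueSeq (hA : IsDensity A) : HasSum (eigenvalueSeq A) 1 := by
  refine (Subtype.val_injective.hasSum_iff ?_).mp hA.hasSum_eigenvalueSeq_dimIndex
  intro j hj
  exact hA.eigenvalueSeq_eq_zero (not_lt.mp fun h => hj ⟨⟨j, h⟩, rfl⟩)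

end IsDensity

end

/-! ### The operator `star t ρ σ`: density and partial traces -/

section

variable {ρ σ : H →L[ℂ] H} {t : ℝ}

lemma two_mul_sqrt_mul_abs_im_inner_le (ht0 : 0 ≤ t) (ht1 : t ≤ 1) (p q : H) :
    2 * √(t * (1 - t)) * |(⟪p, q⟫_ℂ).im| ≤ t * ‖p‖ ^ 2 + (1 - t) * ‖q‖ ^ 2 := by
  have h1 : |(⟪p, q⟫_ℂ).im| ≤ ‖p‖ * ‖q‖ := (Complex.abs_im_le_norm _).trans (norm_inner_le_norm _ _)
  have ht : 0 ≤ 1 - t := by linarith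
  calc 2 * √(t * (1 - t)) * |(⟪p, q⟫_ℂ).im| ≤ 2 * √(t * (1 - t)) * (‖p‖ * ‖q‖) := by gcongr
    _ = 2 * (√t * ‖p‖) * (√(1 - t) * ‖q‖) := by rw [Real.sqrt_mul ht0]; ring
    _ ≤ (√t * ‖p‖) ^ 2 + (√(1 - t) * ‖q‖) ^ 2 := two_mul_le_add_sq _ _
    _ = _ := by rw [mul_pow, mul_pow, Real.sq_sqrt ht0, Real.sq_sqrt ht]

lemma star_apply (t : ℝ) (ρ σ : H →L[ℂ] H) (v : H) :
    star t ρ σ v = (t : ℂ) • ρ v + ((1 - t : ℝ) : ℂ) • σ v +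
      (Complex.I * (√(t * (1 - t)) : ℝ)) • (ρ (σ v) - σ (ρ v)) := rfl

lemma inner_star (hρ : ρ.IsPositive) (hσ : σ.IsPositive) (t : ℝ) (v : H) :
    ⟪v, star t ρ σ v⟫_ℂ = ((t * (⟪v, ρ v⟫_ℂ).re + (1 - t) * (⟪v, σ v⟫_ℂ).re -
      2 * √(t * (1 - t)) * (⟪ρ v, σ v⟫_ℂ).im : ℝ) : ℂ) := by
  have h1 : ⟪v, ρ v⟫_ℂ = ((⟪v, ρ v⟫_ℂ).re : ℂ) :=
    Complex.ext rfl (by rw [im_inner_eq_zero hρ]; simp)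
  have h2 : ⟪v, σ v⟫_ℂ = ((⟪v, σ v⟫_ℂ).re : ℂ) :=
    Complex.ext rfl (by rw [im_inner_eq_zero hσ]; simp)
  rw [star_apply, inner_add_right, inner_add_right, inner_smul_right, inner_smul_right,
    inner_smul_right, inner_sub_right, ← hρ.inner_left_eq_inner_right v (σ v),
    ← hσ.inner_left_eq_inner_right v (ρ v), ← inner_conj_symm (σ v) (ρ v), Complex.sub_conj,
    h1, h2]
  simp only [Complex.ofReal_re]
  push_cast
  linear_combination (2 * (√(t * (1 - t)) : ℂ) * ((⟪ρ v, σ v⟫_ℂ).im : ℂ)) * Complex.I_mul_I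

lemma re_inner_star (hρ : ρ.IsPositive) (hσ : σ.IsPositive) (t : ℝ) (v : H) :
    (⟪v, star t ρ σ v⟫_ℂ).re = t * (⟪v, ρ v⟫_ℂ).re + (1 - t) * (⟪v, σ v⟫_ℂ).re -
      2 * √(t * (1 - t)) * (⟪ρ v, σ v⟫_ℂ).im := by
  rw [inner_star hρ hσ, Complex.ofReal_re]

namespace IsDensity

lemma summable_norm_inner_sq (hρ : IsDensity ρ) {w : Set H} (b : HilbertBasis w ℂ H) :
    Summable fun p : w × w => ‖⟪b p.2, ρ (b p.1)⟫_ℂ‖ ^ 2 := by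
  have h2 : Summable fun i => ∑' j, ‖⟪b j, ρ (b i)⟫_ℂ‖ ^ 2 :=
    (hρ.summable_norm_apply_sq b).congr fun i => (hasSum_norm_inner_sq b (ρ (b i))).tsum_eq.symm
  refine (summable_prod_of_nonneg (f := fun p : w × w => ‖⟪b p.2, ρ (b p.1)⟫_ℂ‖ ^ 2) ?_).mpr
    ⟨fun i => (hasSum_norm_inner_sq b (ρ (b i))).summable, h2⟩
  intro p
  rw [Pi.zero_apply]
  positivity

/-- The commutator of two density matrices has trace zero. -/
lemma hasSum_im_inner_apply (hρ : IsDensity ρ) (hσ : IsDensity σ) {w : Set H}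
    (b : HilbertBasis w ℂ H) : HasSum (fun i => (⟪ρ (b i), σ (b i)⟫_ℂ).im) 0 := by
  let F : w × w → ℂ := fun p => ⟪ρ (b p.1), b p.2⟫_ℂ * ⟪b p.2, σ (b p.1)⟫_ℂ
  have hF : Summable F := by
    refine Summable.of_norm_bounded
      ((hρ.summable_norm_inner_sq b).add (hσ.summable_norm_inner_sq b)) fun p => ?_
    simp only [F, norm_mul]
    rw [norm_inner_symm (ρ (b p.1))]
    nlinarith [two_mul_le_add_sq ‖⟪b p.2, ρ (b p.1)⟫_ℂ‖ ‖⟪b p.2, σ (b p.1)⟫_ℂ‖,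
      norm_nonneg ⟪b p.2, ρ (b p.1)⟫_ℂ, norm_nonneg ⟪b p.2, σ (b p.1)⟫_ℂ]
  -- Exchanging the two basis indices conjugates the absolutely summable double series, so its sum
  -- is real.
  have hswap : ∀ p, F p.swap = (starRingEnd ℂ) (F p) := by
    intro p
    simp only [F, Prod.fst_swap, Prod.snd_swap, map_mul, inner_conj_symm]
    rw [hρ.1.inner_left_eq_inner_right, hσ.1.inner_left_eq_inner_right]
  have hG := Complex.hasSum_im hF.hasSum
  have hG' : HasSum (fun p => (F p).im) (-(∑' p, F p).im) := by
    have h := ((Equiv.prodComm w w).hasSum_iff.mpr hG).neg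
    refine h.congr_fun fun p => ?_
    simp [hswap]
  have h0 : (∑' p, F p).im = 0 := by linarith [hG.unique hG']
  rw [h0] at hG
  refine hG.prod_fiberwise fun i => ?_
  exact Complex.hasSum_im (b.hasSum_inner_mul_inner (ρ (b i)) (σ (b i)))

/-- Positivity combines `ρ² ≤ ρ` and `σ² ≤ σ` with AM-GM for the commutator term. The trace is one
because the commutator has trace zero. -/
lemma isDensity_star (hρ : IsDensity ρ) (hσ : IsDensity σ) (ht0 : 0 ≤ t) (ht1 : t ≤ 1) :
    IsDensity (star t ρ σ) := by
  constructor
  · rw [ContinuousLinearMap.isPositive_iff_complex]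
    intro v
    rw [← inner_conj_symm, inner_star hρ.1 hσ.1, Complex.conj_ofReal]
    refine ⟨by simp, ?_⟩
    simp only [RCLike.re_to_complex, Complex.ofReal_re]
    have h1 := two_mul_sqrt_mul_abs_im_inner_le ht0 ht1 (ρ v) (σ v)
    have h2 := mul_le_mul_of_nonneg_left (hρ.norm_apply_sq_le_re_inner v) ht0
    have h3 := mul_le_mul_of_nonneg_left (hσ.norm_apply_sq_le_re_inner v) (sub_nonneg.mpr ht1)
    have h4 := mul_le_mul_of_nonneg_left (le_abs_self (⟪ρ v, σ v⟫_ℂ).im)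
      (by positivity : 0 ≤ 2 * √(t * (1 - t)))
    linarith
  · intro w b
    simp only [re_inner_star hρ.1 hσ.1]
    have := (((hρ.2 w b).mul_left t).add ((hσ.2 w b).mul_left (1 - t))).sub
      ((hρ.hasSum_im_inner_apply hσ b).mul_left (2 * √(t * (1 - t))))
    rwa [mul_one, mul_one, mul_zero, sub_zero, add_sub_cancel] at this

end IsDensity

/-- The sum of the diagonal elements of `star t ρ σ` over a finite orthonormal family, bounded by
those of `ρ` and `σ` and the off-diagonal blocks of `ρ` and `σ`. -/
lemma sum_re_inner_star_le (hρ : ρ.IsPositive) (hσ : σ.IsPositive) (ht0 : 0 ≤ t) (ht1 : t ≤ 1)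
    {ι : Type*} [Fintype ι] {u : ι → H} (hu : Orthonormal ℂ u) :
    ∑ i, (⟪u i, star t ρ σ (u i)⟫_ℂ).re ≤
      t * (∑ i, (⟪u i, ρ (u i)⟫_ℂ).re + ∑ i, ‖residual u (ρ (u i))‖ ^ 2) +
      (1 - t) * (∑ i, (⟪u i, σ (u i)⟫_ℂ).re + ∑ i, ‖residual u (σ (u i))‖ ^ 2) := by
  have him : ∑ i, (⟪ρ (u i), σ (u i)⟫_ℂ).im =
      ∑ i, (⟪residual u (ρ (u i)), residual u (σ (u i))⟫_ℂ).im := by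
    -- The diagonal blocks drop out: exchanging `i` and `l` conjugates each summand.
    have hz : ∑ i, ∑ l, (⟪ρ (u i), u l⟫_ℂ * ⟪u l, σ (u i)⟫_ℂ).im = 0 := by
      have h : ∑ i, ∑ l, (⟪ρ (u i), u l⟫_ℂ * ⟪u l, σ (u i)⟫_ℂ).im =
          -∑ i, ∑ l, (⟪ρ (u i), u l⟫_ℂ * ⟪u l, σ (u i)⟫_ℂ).im := by
        conv_lhs => rw [Finset.sum_comm]
        simp only [← Finset.sum_neg_distrib]
        refine Finset.sum_congr rfl fun i _ => Finset.sum_congr rfl fun l _ => ?_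
        rw [← Complex.conj_im, map_mul, inner_conj_symm, inner_conj_symm,
          hρ.inner_left_eq_inner_right, hσ.inner_left_eq_inner_right]
      linarith
    simp only [inner_residual_residual hu, Complex.sub_im, Complex.im_sum, Finset.sum_sub_distrib,
      hz, sub_zero]
  have hterm : -(2 * √(t * (1 - t)) * ∑ i, (⟪ρ (u i), σ (u i)⟫_ℂ).im) ≤
      t * ∑ i, ‖residual u (ρ (u i))‖ ^ 2 + (1 - t) * ∑ i, ‖residual u (σ (u i))‖ ^ 2 := by
    rw [him, Finset.mul_sum, Finset.mul_sum, Finset.mul_sum, ← Finset.sum_neg_distrib,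
      ← Finset.sum_add_distrib]
    refine Finset.sum_le_sum fun i _ => ?_
    refine le_trans ?_ (two_mul_sqrt_mul_abs_im_inner_le ht0 ht1 _ _)
    rw [← mul_neg]
    gcongr
    exact neg_le_abs _
  simp only [re_inner_star hρ hσ, Finset.sum_sub_distrib, Finset.sum_add_distrib, ← Finset.mul_sum]
  linarith

end

/-! ### The off-diagonal block estimate -/

section

section Compression

variable {ι : Type*} [Fintype ι] {u e : ι → H}

lemma re_inner_self_eq (x : H) : (⟪x, x⟫_ℂ).re = ‖x‖ ^ 2 := inner_self_eq_norm_sq (𝕜 := ℂ) x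

/-- With `D = ∑ d j |e j⟩⟨e j|` and `P`, `Q` the projections onto the span of `u` and its
complement, `‖QDP‖² = tr(QD²Q) - tr((QDQ)²)`. The second trace is `∑ d j d l |⟪Q e j, Q e l⟫|²`, of
which only the terms `l = j` are kept. They are needed for the equality case. -/
lemma sum_norm_residual_sum_le (hu : Orthonormal ℂ u) (he : Orthonormal ℂ e) {d : ι → ℝ}
    (hd : ∀ j, 0 ≤ d j) :
    ∑ i, ‖residual u (∑ j, ((d j : ℂ) * ⟪e j, u i⟫_ℂ) • e j)‖ ^ 2 ≤
      ∑ j, (d j ^ 2 * ‖residual u (e j)‖ ^ 2 - (d j * ‖residual u (e j)‖ ^ 2) ^ 2) := by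
  classical
  have hpair : ∀ j l, ∑ i, ⟪u i, e j⟫_ℂ * ⟪e l, u i⟫_ℂ =
      (if l = j then 1 else 0) - ⟪residual u (e l), residual u (e j)⟫_ℂ := by
    intro j l
    rw [inner_residual_residual hu, orthonormal_iff_ite.mp he, sub_sub_cancel]
    exact Finset.sum_congr rfl fun i _ => mul_comm _ _
  have hexp : ∀ i, (‖residual u (∑ j, ((d j : ℂ) * ⟪e j, u i⟫_ℂ) • e j)‖ ^ 2 : ℝ) =
      (∑ j, ∑ l, (d j * d l : ℂ) * ⟪residual u (e j), residual u (e l)⟫_ℂ *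
        (⟪u i, e j⟫_ℂ * ⟪e l, u i⟫_ℂ)).re := by
    intro i
    rw [← re_inner_self_eq, residual_sum, sum_inner]
    congr 1
    refine Finset.sum_congr rfl fun j _ => ?_
    rw [inner_sum]
    refine Finset.sum_congr rfl fun l _ => ?_
    rw [residual_smul, residual_smul, inner_smul_left, inner_smul_right, map_mul,
      Complex.conj_ofReal, inner_conj_symm]
    ring
  simp only [hexp]
  rw [← Complex.re_sum, Finset.sum_comm, Complex.re_sum]
  refine Finset.sum_le_sum fun j _ => ?_
  rw [Finset.sum_comm, Complex.re_sum]
  have hterm : ∀ l, (∑ i, (d j * d l : ℂ) * ⟪residual u (e j), residual u (e l)⟫_ℂ *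
        (⟪u i, e j⟫_ℂ * ⟪e l, u i⟫_ℂ)).re =
      (if l = j then d j ^ 2 * ‖residual u (e j)‖ ^ 2 else 0) -
        d j * d l * ‖⟪residual u (e j), residual u (e l)⟫_ℂ‖ ^ 2 := by
    intro l
    have hcm : ⟪residual u (e j), residual u (e l)⟫_ℂ * ⟪residual u (e l), residual u (e j)⟫_ℂ =
        ((‖⟪residual u (e j), residual u (e l)⟫_ℂ‖ ^ 2 : ℝ) : ℂ) := by
      rw [← inner_conj_symm (residual u (e l)), Complex.mul_conj', Complex.ofReal_pow]
    rw [← Finset.mul_sum, hpair, mul_sub, mul_assoc _ _ ⟪residual u (e l), _⟫_ℂ, hcm,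
      Complex.sub_re, ← Complex.ofReal_mul, ← Complex.ofReal_mul, Complex.ofReal_re]
    congr 1
    split_ifs with h
    · subst h
      rw [mul_one, Complex.re_ofReal_mul, re_inner_self_eq, sq (d l)]
    · simp
  simp only [hterm]
  rw [Finset.sum_sub_distrib, Finset.sum_ite_eq' Finset.univ j, if_pos (Finset.mem_univ _)]
  gcongr
  have hs := Finset.single_le_sum
    (f := fun l => d j * d l * ‖⟪residual u (e j), residual u (e l)⟫_ℂ‖ ^ 2)
    (fun l _ => by have := hd j; have := hd l; positivity) (Finset.mem_univ j)
  refine le_trans (le_of_eq ?_) hs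
  have : ‖⟪residual u (e j), residual u (e j)⟫_ℂ‖ = ‖residual u (e j)‖ ^ 2 := by
    rw [inner_self_eq_norm_sq_to_K]; simp
  simp only [this]
  ring

/-- `B² ≤ c B` bounds `‖B (u i)‖²`. Of the part of `B (u i)` inside the span only the component
along `u i` is subtracted, and it supplies the quadratic term for the equality case. -/
lemma sum_norm_residual_apply_le (hu : Orthonormal ℂ u) {B : H →L[ℂ] H} (hB : B.IsPositive)
    {c : ℝ} (hc : ∀ v, (⟪v, B v⟫_ℂ).re ≤ c * ‖v‖ ^ 2) :
    ∑ i, ‖residual u (B (u i))‖ ^ 2 ≤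
      ∑ i, (c * (⟪u i, B (u i)⟫_ℂ).re - (⟪u i, B (u i)⟫_ℂ).re ^ 2) := by
  refine Finset.sum_le_sum fun i _ => ?_
  rw [norm_residual_sq hu]
  have h1 := norm_apply_sq_le hB (u i) (hc _)
  have h2 := Finset.single_le_sum (f := fun l => ‖⟪u l, B (u i)⟫_ℂ‖ ^ 2)
    (fun l _ => by positivity) (Finset.mem_univ i)
  have h3 : (⟪u i, B (u i)⟫_ℂ).re ^ 2 ≤ ‖⟪u i, B (u i)⟫_ℂ‖ ^ 2 :=
    sq_le_sq' (by linarith [neg_abs_le (⟪u i, B (u i)⟫_ℂ).re,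
      Complex.abs_re_le_norm ⟪u i, B (u i)⟫_ℂ]) (Complex.re_le_norm _)
  linarith

/-- If `A = c + D - B` with `D` diagonal in the family `e`, with entries in `[0, α]`, and
`0 ≤ B ≤ c`, then the off-diagonal block of `A` with respect to the family `u` is controlled by
the difference of the diagonal sums over `e` and over `u`. -/
lemma sum_norm_residual_le_of_decomposition (hu : Orthonormal ℂ u) (he : Orthonormal ℂ e)
    {d : ι → ℝ} {α c : ℝ} (hd : ∀ j, 0 ≤ d j) (hdα : ∀ j, d j ≤ α) (hα : 0 ≤ α) (hc0 : 0 ≤ c)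
    (hαc : α + c ≤ 1) {A B : H →L[ℂ] H} (hB : B.IsPositive)
    (hc : ∀ v, (⟪v, B v⟫_ℂ).re ≤ c * ‖v‖ ^ 2)
    (hA : ∀ v, A v = (c : ℂ) • v + ∑ j, ((d j : ℂ) * ⟪e j, v⟫_ℂ) • e j - B v) :
    ∑ i, ‖residual u (A (u i))‖ ^ 2 ≤ ∑ j, (c + d j) - ∑ i, (⟪u i, A (u i)⟫_ℂ).re ∧
    (∑ i, ‖residual u (A (u i))‖ ^ 2 = ∑ j, (c + d j) - ∑ i, (⟪u i, A (u i)⟫_ℂ).re →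
      ∑ j, (c + d j) - ∑ i, (⟪u i, A (u i)⟫_ℂ).re = 0) := by
  set p : ι → H := fun i => residual u (∑ j, ((d j : ℂ) * ⟪e j, u i⟫_ℂ) • e j) with hp
  set q : ι → H := fun i => residual u (B (u i)) with hq
  set f : ι → ℝ := fun j => ‖residual u (e j)‖ ^ 2 with hf
  set y : ι → ℝ := fun i => (⟪u i, B (u i)⟫_ℂ).re with hy
  have hres : ∀ i, residual u (A (u i)) = p i - q i := by
    intro i
    rw [hA, residual_sub, residual_add, residual_smul, residual_self hu, smul_zero, zero_add]
  have hf0 : ∀ j, 0 ≤ f j := fun j => by positivity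
  have hy0 : ∀ i, 0 ≤ y i := fun i => re_inner_nonneg hB _
  have hX : ∑ i, ‖p i‖ ^ 2 ≤ ∑ j, (d j ^ 2 * f j - (d j * f j) ^ 2) :=
    sum_norm_residual_sum_le hu he hd
  have hY : ∑ i, ‖q i‖ ^ 2 ≤ ∑ i, (c * y i - y i ^ 2) := sum_norm_residual_apply_le hu hB hc
  have hX' : ∑ i, ‖p i‖ ^ 2 ≤ α * ∑ j, d j * f j - ∑ j, (d j * f j) ^ 2 := by
    refine hX.trans ?_
    rw [Finset.sum_sub_distrib, Finset.mul_sum]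
    refine sub_le_sub_right (Finset.sum_le_sum fun j _ => ?_) _
    rw [sq, mul_assoc]
    exact mul_le_mul_of_nonneg_right (hdα j) (mul_nonneg (hd j) (hf0 j))
  have hY' : ∑ i, ‖q i‖ ^ 2 ≤ c * ∑ i, y i - ∑ i, y i ^ 2 := by
    rwa [Finset.sum_sub_distrib, ← Finset.mul_sum] at hY
  -- The scalar `c` cancels because `u` and `e` have the same index type.
  have ha : ∑ j, (c + d j) - ∑ i, (⟪u i, A (u i)⟫_ℂ).re = ∑ j, d j * f j + ∑ i, y i := by
    have h1 : ∀ i, (⟪u i, A (u i)⟫_ℂ).re = c + ∑ j, d j * ‖⟪u i, e j⟫_ℂ‖ ^ 2 - y i := by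
      intro i
      rw [hA, inner_sub_right, inner_add_right, inner_smul_right, inner_sum, Complex.sub_re,
        Complex.add_re, Complex.re_ofReal_mul, re_inner_self_eq, hu.1, one_pow, mul_one,
        Complex.re_sum]
      congr 2
      refine Finset.sum_congr rfl fun j _ => ?_
      rw [inner_smul_right, mul_assoc, Complex.re_ofReal_mul, ← inner_conj_symm (e j),
        Complex.conj_mul', ← Complex.ofReal_pow, Complex.ofReal_re]
    have h2 : ∀ j, d j * f j = d j - ∑ i, d j * ‖⟪u i, e j⟫_ℂ‖ ^ 2 := by
      intro j
      simp only [hf, norm_residual_sq hu, he.1, one_pow, mul_sub, mul_one, Finset.mul_sum]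
    simp only [h1, h2, Finset.sum_sub_distrib, Finset.sum_add_distrib]
    rw [Finset.sum_comm (f := fun i j => d j * ‖⟪u i, e j⟫_ℂ‖ ^ 2)]
    ring
  set X := ∑ i, ‖p i‖ ^ 2
  set Y := ∑ i, ‖q i‖ ^ 2
  set x := ∑ j, d j * f j
  set z := ∑ i, y i
  have hX0 : 0 ≤ X := Finset.sum_nonneg fun i _ => by positivity
  have hY0 : 0 ≤ Y := Finset.sum_nonneg fun i _ => by positivity
  have hx0 : 0 ≤ x := Finset.sum_nonneg fun j _ => mul_nonneg (hd j) (hf0 j)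
  have hz0 : 0 ≤ z := Finset.sum_nonneg fun i _ => hy0 i
  have hxs : 0 ≤ ∑ j, (d j * f j) ^ 2 := Finset.sum_nonneg fun j _ => by positivity
  have hzs : 0 ≤ ∑ i, y i ^ 2 := Finset.sum_nonneg fun j _ => by positivity
  have hN : ∑ i, ‖residual u (A (u i))‖ ^ 2 ≤ X + Y + 2 * (√X * √Y) := by
    have hcs := Real.sum_mul_le_sqrt_mul_sqrt Finset.univ (fun i => ‖p i‖) (fun i => ‖q i‖)
    calc ∑ i, ‖residual u (A (u i))‖ ^ 2 ≤ ∑ i, (‖p i‖ ^ 2 + ‖q i‖ ^ 2 + 2 * (‖p i‖ * ‖q i‖)) := by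
          refine Finset.sum_le_sum fun i _ => ?_
          rw [hres]
          have := pow_le_pow_left₀ (norm_nonneg _) (norm_sub_le (p i) (q i)) 2
          linarith [add_sq ‖p i‖ ‖q i‖]
      _ = X + Y + 2 * ∑ i, ‖p i‖ * ‖q i‖ := by
          rw [Finset.sum_add_distrib, Finset.sum_add_distrib, ← Finset.mul_sum]
      _ ≤ _ := by gcongr
  -- From `X ≤ αx` and `Y ≤ cz`, regroup `(αx)(cz) = (αz)(cx)` and apply AM-GM.
  have hr : 2 * (√X * √Y) ≤ α * z + c * x := by
    refine abs_le_of_sq_le_sq' ?_ (by positivity) |>.2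
    rw [mul_pow, mul_pow, Real.sq_sqrt hX0, Real.sq_sqrt hY0]
    have h1 : X * Y ≤ (α * x) * (c * z) :=
      mul_le_mul (by linarith) (by linarith) hY0 (by positivity)
    nlinarith [sq_nonneg (α * z - c * x)]
  have hsum : (α + c) * (x + z) ≤ 1 * (x + z) := by gcongr
  rw [ha]
  refine ⟨by linarith, fun heq => ?_⟩
  -- Equality leaves no room for the subtracted squares.
  have h1 : ∑ j, (d j * f j) ^ 2 = 0 := by linarith
  have h2 : ∑ i, y i ^ 2 = 0 := by linarith
  rw [Finset.sum_eq_zero_iff_of_nonneg fun _ _ => sq_nonneg _] at h1 h2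
  have hx : x = 0 := Finset.sum_eq_zero fun j hj => pow_eq_zero_iff two_ne_zero |>.mp (h1 j hj)
  have hz : z = 0 := Finset.sum_eq_zero fun j hj => pow_eq_zero_iff two_ne_zero |>.mp (h2 j hj)
  rw [hx, hz, add_zero]

/-- Splitting off a finite family of eigenvectors from a quadratic form. -/
lemma re_inner_eq_residual_add {A : H →L[ℂ] H} (hA : A.IsPositive) (he : Orthonormal ℂ e)
    {m : ι → ℝ} (heig : ∀ j, A (e j) = (m j : ℂ) • e j) (v : H) :
    (⟪v, A v⟫_ℂ).re = (⟪residual e v, A (residual e v)⟫_ℂ).re + ∑ j, m j * ‖⟪e j, v⟫_ℂ‖ ^ 2 := by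
  have h1 : A (residual e v) = A v - ∑ j, ((m j : ℂ) * ⟪e j, v⟫_ℂ) • e j := by
    rw [residual, map_sub, map_sum]
    congr 1
    refine Finset.sum_congr rfl fun j _ => ?_
    rw [map_smul, heig, smul_smul, mul_comm]
  have h2 : ∀ j, ⟪e j, A (residual e v)⟫_ℂ = 0 := by
    intro j
    rw [← hA.inner_left_eq_inner_right, heig, inner_smul_left, inner_residual he, mul_zero]
  have h3 : ⟪residual e v, A (residual e v)⟫_ℂ = ⟪v, A (residual e v)⟫_ℂ := by
    conv_lhs => rw [residual]
    rw [inner_sub_left, sum_inner]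
    simp only [← residual.eq_1, inner_smul_left, h2, mul_zero, Finset.sum_const_zero, sub_zero]
  rw [h3, h1, inner_sub_right, Complex.sub_re, inner_sum, Complex.re_sum]
  have h4 : ∑ j, (⟪v, ((m j : ℂ) * ⟪e j, v⟫_ℂ) • e j⟫_ℂ).re = ∑ j, m j * ‖⟪e j, v⟫_ℂ‖ ^ 2 := by
    refine Finset.sum_congr rfl fun j _ => ?_
    rw [inner_smul_right, mul_assoc, Complex.re_ofReal_mul, ← inner_conj_symm v, Complex.mul_conj',
      ← Complex.ofReal_pow, Complex.ofReal_re]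
  rw [h4, sub_add_cancel]

end Compression

/-- The off-diagonal block of a density matrix with respect to an orthonormal family of `k`
vectors is controlled by the amount by which the diagonal sum over the family falls short of the
sum of the `k` largest eigenvalues. -/
lemma IsDensity.sum_norm_residual_le {A : H →L[ℂ] H} (hA : IsDensity A) {k : ℕ}
    (hk : (k : Cardinal.{u}) ≤ Module.rank ℂ H) {u : Fin k → H} (hu : Orthonormal ℂ u) :
    ∑ i, ‖residual u (A (u i))‖ ^ 2 ≤
      ∑ j ∈ Finset.range k, eigenvalueSeq A j - ∑ i, (⟪u i, A (u i)⟫_ℂ).re ∧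
    (∑ i, ‖residual u (A (u i))‖ ^ 2 =
        ∑ j ∈ Finset.range k, eigenvalueSeq A j - ∑ i, (⟪u i, A (u i)⟫_ℂ).re →
      ∑ j ∈ Finset.range k, eigenvalueSeq A j - ∑ i, (⟪u i, A (u i)⟫_ℂ).re = 0) := by
  rcases k with _ | n
  · simp
  obtain ⟨φ, hφ, heig, -, hmax⟩ := hA.exists_eigensystem
  have hlt : ∀ i : ℕ, i < n + 1 → (i : Cardinal.{u}) < Module.rank ℂ H := fun i hi =>
    lt_of_lt_of_le (by exact_mod_cast hi) hk
  set l := eigenvalueSeq A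
  have hanti : Antitone l := hA.antitone_eigenvalueSeq
  have hl0 : ∀ j, 0 ≤ l j := hA.eigenvalueSeq_nonneg
  let e : Fin (n + 1) → H := fun i => φ ⟨i, hlt i i.2⟩
  have he : Orthonormal ℂ e := hφ.comp _ fun a b h => Fin.ext (congrArg Subtype.val h)
  have hee : ∀ i, A (e i) = (l i : ℂ) • e i := fun i => heig _
  let d : Fin (n + 1) → ℝ := fun j => l j - l n
  have hd : ∀ j, 0 ≤ d j := fun j => sub_nonneg.mpr (hanti (Nat.lt_succ_iff.mp j.2))
  -- `B` is `l n - A` on the complement of `e` and zero on its span. The `k`-th eigenvalue is `l n`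
  -- because indices start at `0` and `k = n + 1`.
  let B : H →L[ℂ] H := (l n : ℂ) • (1 : H →L[ℂ] H) +
    ∑ j, (d j : ℂ) • InnerProductSpace.rankOne ℂ (e j) (e j) - A
  have hBv : ∀ v, B v = (l n : ℂ) • v + ∑ j, ((d j : ℂ) * ⟪e j, v⟫_ℂ) • e j - A v := by
    intro v
    simp [B, mul_smul]
  have hBre : ∀ v, (⟪v, B v⟫_ℂ).re =
      l n * ‖residual e v‖ ^ 2 - (⟪residual e v, A (residual e v)⟫_ℂ).re := by
    intro v
    rw [hBv, inner_sub_right, Complex.sub_re, re_inner_eq_residual_add hA.1 he hee,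
      inner_add_right, Complex.add_re, inner_smul_right, Complex.re_ofReal_mul, re_inner_self_eq,
      inner_sum, Complex.re_sum, norm_residual_sq he]
    have h4 : ∑ j, (⟪v, ((d j : ℂ) * ⟪e j, v⟫_ℂ) • e j⟫_ℂ).re =
        ∑ j : Fin (n + 1), (l j * ‖⟪e j, v⟫_ℂ‖ ^ 2 - l n * ‖⟪e j, v⟫_ℂ‖ ^ 2) := by
      refine Finset.sum_congr rfl fun j _ => ?_
      rw [inner_smul_right, mul_assoc, Complex.re_ofReal_mul, ← inner_conj_symm v,
        Complex.mul_conj', ← Complex.ofReal_pow, Complex.ofReal_re, ← sub_mul]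
    rw [h4, Finset.sum_sub_distrib, ← Finset.mul_sum]
    ring
  have hBpos : B.IsPositive := by
    refine ⟨?_, fun v => ?_⟩
    · have h1 : ((l n : ℂ) • (1 : H →L[ℂ] H)).IsPositive :=
        ContinuousLinearMap.isPositive_one.smul_of_nonneg (by exact_mod_cast hl0 n)
      have h2 : (∑ j, (d j : ℂ) • InnerProductSpace.rankOne ℂ (e j) (e j)).IsPositive :=
        ContinuousLinearMap.isPositive_sum _ fun j _ =>
          (InnerProductSpace.isPositive_rankOne_self (e j)).smul_of_nonneg
            (by exact_mod_cast hd j)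
      exact (h1.add h2).isSymmetric.sub hA.1.isSymmetric
    · rw [ContinuousLinearMap.reApplyInnerSelf_apply, inner_re_symm]
      refine (le_of_le_of_eq (sub_nonneg.mpr ?_) (hBre v).symm)
      exact hmax ⟨n, hlt n n.lt_succ_self⟩ _ fun i hi =>
        inner_residual he ⟨i, hi.trans n.lt_succ_self⟩ v
  have hBc : ∀ v, (⟪v, B v⟫_ℂ).re ≤ l n * ‖v‖ ^ 2 := by
    intro v
    rw [hBre, norm_residual_sq he]
    have h1 := re_inner_nonneg hA.1 (residual e v)
    have h2 : 0 ≤ l n * ∑ j, ‖⟪e j, v⟫_ℂ‖ ^ 2 :=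
      mul_nonneg (hl0 n) (Finset.sum_nonneg fun _ _ => by positivity)
    linarith
  have hl1 : l 0 ≤ 1 := le_hasSum hA.hasSum_eigenvalueSeq 0 fun j _ => hl0 j
  have key := sum_norm_residual_le_of_decomposition hu he hd (α := l 0 - l n) (c := l n) (A := A)
    (fun j => sub_le_sub_right (hanti (Nat.zero_le _)) _) (sub_nonneg.mpr (hanti (Nat.zero_le _)))
    (hl0 n) (by linarith) hBpos hBc (fun v => by rw [hBv]; abel)
  have hs : ∑ j ∈ Finset.range (n + 1), l j = ∑ j, (l n + d j) := by
    rw [Finset.sum_range]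
    simp [d]
  rwa [hs]

end

/-! ### Majorization and the case of equality -/

section

variable {A ρ σ : H →L[ℂ] H} {t : ℝ}

/-- The first `k` members of a family indexed by the natural numbers below the dimension. -/
def initialFamily (φ : DimIndex H → H) (k : ℕ) (hk : (k : Cardinal.{u}) ≤ Module.rank ℂ H) :
    Fin k → H :=
  fun i => φ ⟨i, lt_of_lt_of_le (by exact_mod_cast i.2) hk⟩

lemma orthonormal_initialFamily {φ : DimIndex H → H} (hφ : Orthonormal ℂ φ) {k : ℕ}
    (hk : (k : Cardinal.{u}) ≤ Module.rank ℂ H) : Orthonormal ℂ (initialFamily φ k hk) :=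
  hφ.comp _ fun _ _ h => Fin.ext (congrArg Subtype.val h)

lemma natCast_succ_le_of_lt {j : ℕ} {c : Cardinal.{u}} (h : (j : Cardinal.{u}) < c) :
    ((j + 1 : ℕ) : Cardinal.{u}) ≤ c := by
  rw [Nat.cast_succ, ← Cardinal.succ_natCast]
  exact Order.succ_le_of_lt h

lemma re_inner_apply_eigenvector {v : H} (hv : ‖v‖ = 1) {c : ℝ} (h : A v = (c : ℂ) • v) :
    (⟪v, A v⟫_ℂ).re = c := by
  rw [h, inner_smul_right, Complex.re_ofReal_mul, re_inner_self_eq, hv, one_pow, mul_one]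

/-- An orthonormal family all of whose initial segments reduce a density matrix and carry the
largest possible trace consists of eigenvectors, in the order of the eigenvalues. -/
lemma IsDensity.eigensystem_of_initialFamily (hA : IsDensity A) {φ : DimIndex H → H}
    (hφ : Orthonormal ℂ φ)
    (hN : ∀ k hk, ∑ i, ‖residual (initialFamily φ k hk) (A (initialFamily φ k hk i))‖ ^ 2 = 0)
    (ha : ∀ k hk, ∑ j ∈ Finset.range k, eigenvalueSeq A j =
      ∑ i, (⟪initialFamily φ k hk i, A (initialFamily φ k hk i)⟫_ℂ).re) :
    (∀ j : DimIndex H, A (φ j) = (eigenvalueSeq A j : ℂ) • φ j) ∧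
      ∀ v, (∀ j, ⟪φ j, v⟫_ℂ = 0) → A v = 0 := by
  have hexp : ∀ (k : ℕ) (hk : (k : Cardinal.{u}) ≤ Module.rank ℂ H) (i : Fin k),
      A (initialFamily φ k hk i) = ∑ l, ⟪initialFamily φ k hk l, A (initialFamily φ k hk i)⟫_ℂ •
        initialFamily φ k hk l := by
    intro k hk i
    have h := (Finset.sum_eq_zero_iff_of_nonneg fun _ _ => sq_nonneg _).mp (hN k hk) i
      (Finset.mem_univ i)
    exact sub_eq_zero.mp (norm_eq_zero.mp (pow_eq_zero_iff two_ne_zero |>.mp h))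
  -- `A (φ i)` lies in the span of the first `i + 1` vectors. By symmetry of `A`, the matrix of `A`
  -- in the family is then diagonal, and subtracting consecutive trace identities identifies its
  -- entries.
  have hlt : ∀ i j : DimIndex H, (i : ℕ) < j → ⟪A (φ i), φ j⟫_ℂ = 0 := by
    intro i j hij
    have h := hexp (i + 1) (natCast_succ_le_of_lt i.2) (Fin.last i)
    have h1 : initialFamily φ (i + 1) (natCast_succ_le_of_lt i.2) (Fin.last i) = φ i := rfl
    rw [h1] at h
    rw [h, sum_inner]
    refine Finset.sum_eq_zero fun l _ => ?_
    have h2 : ⟪initialFamily φ (i + 1) (natCast_succ_le_of_lt i.2) l, φ j⟫_ℂ = 0 := by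
      refine hφ.2 fun h => ?_
      have := congrArg Subtype.val h
      have h3 := l.2
      simp only at this
      omega
    rw [inner_smul_left, h2, mul_zero]
  have heig : ∀ j : DimIndex H, A (φ j) = (eigenvalueSeq A j : ℂ) • φ j := by
    intro j
    have hj := natCast_succ_le_of_lt j.2
    have h := hexp (j + 1) hj (Fin.last j)
    have h1 : initialFamily φ (j + 1) hj (Fin.last j) = φ j := rfl
    rw [Fin.sum_univ_castSucc, h1, Finset.sum_eq_zero, zero_add] at h
    · have h2 := ha (j + 1) hj
      have h3 := ha j j.2.le
      rw [Fin.sum_univ_castSucc, Finset.sum_range_succ, h3, h1] at h2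
      have h4 : ⟪φ j, A (φ j)⟫_ℂ = (eigenvalueSeq A j : ℂ) :=
        Complex.ext (add_left_cancel h2).symm (by rw [im_inner_eq_zero hA.1]; simp)
      rwa [h4] at h
    · intro l _
      have h5 : ⟪initialFamily φ (j + 1) hj l.castSucc, A (φ j)⟫_ℂ = 0 := by
        rw [← hA.1.inner_left_eq_inner_right]
        exact hlt _ _ l.2
      rw [h5, zero_smul]
  refine ⟨heig, fun v hv => hA.apply_eq_zero_of_hasSum hφ ?_ hv⟩
  have : ∀ j, (⟪φ j, A (φ j)⟫_ℂ).re = eigenvalueSeq A j := fun j =>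
    re_inner_apply_eigenvector (hφ.1 j) (heig j)
  simp only [this]
  exact hA.hasSum_eigenvalueSeq_dimIndex

lemma sum_range_initialFamily {φ : DimIndex H → H} (hφ : Orthonormal ℂ φ)
    (heig : ∀ j : DimIndex H, A (φ j) = (eigenvalueSeq A j : ℂ) • φ j) {k : ℕ}
    (hk : (k : Cardinal.{u}) ≤ Module.rank ℂ H) :
    ∑ j ∈ Finset.range k, eigenvalueSeq A j =
      ∑ i, (⟪initialFamily φ k hk i, A (initialFamily φ k hk i)⟫_ℂ).re := by
  rw [Finset.sum_range]
  exact Finset.sum_congr rfl fun i _ =>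
    (re_inner_apply_eigenvector (hφ.1 _) (heig ⟨i, _⟩)).symm

lemma isMajorizedBy_star (hρ : IsDensity ρ) (hσ : IsDensity σ) (ht0 : 0 ≤ t) (ht1 : t ≤ 1) :
    IsMajorizedBy (eigenvalueSeq (star t ρ σ))
      (fun j => t * eigenvalueSeq ρ j + (1 - t) * eigenvalueSeq σ j) := by
  have hτ := hρ.isDensity_star hσ ht0 ht1
  have ht : 0 ≤ 1 - t := sub_nonneg.mpr ht1
  have hsum := (hρ.hasSum_eigenvalueSeq.mul_left t).add (hσ.hasSum_eigenvalueSeq.mul_left (1 - t))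
  refine ⟨hτ.antitone_eigenvalueSeq, fun i j hij => ?_, hτ.eigenvalueSeq_nonneg, fun j => ?_,
    hτ.hasSum_eigenvalueSeq.summable, hsum.summable, ?_, fun k => ?_⟩
  · exact add_le_add (mul_le_mul_of_nonneg_left (hρ.antitone_eigenvalueSeq hij) ht0)
      (mul_le_mul_of_nonneg_left (hσ.antitone_eigenvalueSeq hij) ht)
  · exact add_nonneg (mul_nonneg ht0 (hρ.eigenvalueSeq_nonneg j))
      (mul_nonneg ht (hσ.eigenvalueSeq_nonneg j))
  · rw [hτ.hasSum_eigenvalueSeq.tsum_eq, hsum.tsum_eq]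
    ring
  · have main : ∀ k : ℕ, (k : Cardinal.{u}) ≤ Module.rank ℂ H →
        ∑ j ∈ Finset.range k, eigenvalueSeq (star t ρ σ) j ≤
          ∑ j ∈ Finset.range k, (t * eigenvalueSeq ρ j + (1 - t) * eigenvalueSeq σ j) := by
      intro k hk
      obtain ⟨φ, hφ, heig, -⟩ := hτ.exists_eigensystem
      have hu := orthonormal_initialFamily hφ hk
      rw [sum_range_initialFamily hφ heig hk, Finset.sum_add_distrib, ← Finset.mul_sum,
        ← Finset.mul_sum]
      have h1 := mul_le_mul_of_nonneg_left (hρ.sum_norm_residual_le hk hu).1 ht0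
      have h2 := mul_le_mul_of_nonneg_left (hσ.sum_norm_residual_le hk hu).1 ht
      linarith [sum_re_inner_star_le hρ.1 hσ.1 ht0 ht1 hu]
    rcases le_or_gt (k : Cardinal.{u}) (Module.rank ℂ H) with hk | hk
    · exact main k hk
    -- Beyond the dimension `d` all three sequences vanish, so the partial sums are those at `d`.
    · obtain ⟨d, hd⟩ := Cardinal.lt_aleph0.mp (hk.trans Cardinal.natCast_lt_aleph0)
      have hdk : d ≤ k := by
        rw [hd] at hk
        exact_mod_cast hk.le
      have hz : ∀ j ∈ Finset.range k, j ∉ Finset.range d → Module.rank ℂ H ≤ j := by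
        intro j _ hj
        rw [hd]
        exact_mod_cast not_lt.mp (mt Finset.mem_range.mpr hj)
      have hsub := Finset.range_mono hdk
      have := main d hd.ge
      rwa [Finset.sum_subset hsub fun j h1 h2 => hτ.eigenvalueSeq_eq_zero (hz j h1 h2),
        Finset.sum_subset hsub fun j h1 h2 => by
          rw [hρ.eigenvalueSeq_eq_zero (hz j h1 h2), hσ.eigenvalueSeq_eq_zero (hz j h1 h2)]
          simp] at this

lemma star_zero (ρ σ : H →L[ℂ] H) : star 0 ρ σ = σ := by simp [star]

lemma star_one (ρ σ : H →L[ℂ] H) : star 1 ρ σ = ρ := by simp [star]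

lemma HasOrderedEigensystem.eigenvalueSeq_star (hρ : IsDensity ρ) (hσ : IsDensity σ)
    (ht0 : 0 ≤ t) (ht1 : t ≤ 1) (h : HasOrderedEigensystem ρ σ) (j : ℕ) :
    t * eigenvalueSeq ρ j + (1 - t) * eigenvalueSeq σ j = eigenvalueSeq (star t ρ σ) j := by
  obtain ⟨φ, hφ, heig, hzero⟩ := h
  have hm := isMajorizedBy_star hρ hσ ht0 ht1
  refine (eigenvalueSeq_eq (hρ.isDensity_star hσ ht0 ht1).1 hφ hm.antitone_right hm.nonneg_right
    (fun j => ?_) (fun v hv => ?_) (fun j hj => ?_) j).symm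
  · rw [star_apply, (heig j).1, (heig j).2, map_smul, map_smul, (heig j).1, (heig j).2,
      smul_comm (eigenvalueSeq ρ j : ℂ), sub_self, smul_zero, add_zero, smul_smul, smul_smul,
      ← add_smul]
    push_cast
    rfl
  · rw [star_apply, (hzero v hv).1, (hzero v hv).2]
    simp
  · rw [hρ.eigenvalueSeq_eq_zero hj, hσ.eigenvalueSeq_eq_zero hj]
    simp

lemma hasOrderedEigensystem_of_eigenvalueSeq_star_eq (hρ : IsDensity ρ) (hσ : IsDensity σ)
    (ht0 : 0 < t) (ht1 : t < 1)
    (h : ∀ j, t * eigenvalueSeq ρ j + (1 - t) * eigenvalueSeq σ j =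
      eigenvalueSeq (star t ρ σ) j) : HasOrderedEigensystem ρ σ := by
  have ht : 0 < 1 - t := sub_pos.mpr ht1
  obtain ⟨φ, hφ, heig, -⟩ := (hρ.isDensity_star hσ ht0.le ht1.le).exists_eigensystem
  have key : ∀ k hk,
      (∑ i, ‖residual (initialFamily φ k hk) (ρ (initialFamily φ k hk i))‖ ^ 2 = 0 ∧
        ∑ j ∈ Finset.range k, eigenvalueSeq ρ j =
          ∑ i, (⟪initialFamily φ k hk i, ρ (initialFamily φ k hk i)⟫_ℂ).re) ∧
      (∑ i, ‖residual (initialFamily φ k hk) (σ (initialFamily φ k hk i))‖ ^ 2 = 0 ∧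
        ∑ j ∈ Finset.range k, eigenvalueSeq σ j =
          ∑ i, (⟪initialFamily φ k hk i, σ (initialFamily φ k hk i)⟫_ℂ).re) := by
    intro k hk
    have hu := orthonormal_initialFamily hφ hk
    have h0 := sum_range_initialFamily hφ heig hk
    simp only [← h, Finset.sum_add_distrib, ← Finset.mul_sum] at h0
    have h1 := sum_re_inner_star_le hρ.1 hσ.1 ht0.le ht1.le hu
    obtain ⟨hρ1, hρ2⟩ := hρ.sum_norm_residual_le hk hu
    obtain ⟨hσ1, hσ2⟩ := hσ.sum_norm_residual_le hk hu
    rw [← h0] at h1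
    -- Both weights are positive, so equality in the weighted sum forces equality for `ρ` and for
    -- `σ` separately.
    have hρ3 := le_antisymm hρ1 (le_of_mul_le_mul_left (by
      linarith [mul_le_mul_of_nonneg_left hσ1 ht.le]) ht0)
    have hσ3 := le_antisymm hσ1 (le_of_mul_le_mul_left (by
      linarith [mul_le_mul_of_nonneg_left hρ1 ht0.le]) ht)
    exact ⟨⟨hρ3.trans (hρ2 hρ3), sub_eq_zero.mp (hρ2 hρ3)⟩,
      ⟨hσ3.trans (hσ2 hσ3), sub_eq_zero.mp (hσ2 hσ3)⟩⟩
  have eρ := hρ.eigensystem_of_initialFamily hφ (fun k hk => (key k hk).1.1)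
    (fun k hk => (key k hk).1.2)
  have eσ := hσ.eigensystem_of_initialFamily hφ (fun k hk => (key k hk).2.1)
    (fun k hk => (key k hk).2.2)
  exact ⟨φ, hφ, fun j => ⟨eρ.1 j, eσ.1 j⟩, fun v hv => ⟨eρ.2 v hv, eσ.2 v hv⟩⟩

lemma eigenvalueSeq_star_eq_iff (hρ : IsDensity ρ) (hσ : IsDensity σ) (ht0 : 0 ≤ t) (ht1 : t ≤ 1) :
    (∀ j, t * eigenvalueSeq ρ j + (1 - t) * eigenvalueSeq σ j = eigenvalueSeq (star t ρ σ) j) ↔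
      t = 0 ∨ t = 1 ∨ HasOrderedEigensystem ρ σ := by
  constructor
  · intro h
    by_cases h0 : t = 0
    · exact Or.inl h0
    by_cases h1 : t = 1
    · exact Or.inr (Or.inl h1)
    exact Or.inr (Or.inr (hasOrderedEigensystem_of_eigenvalueSeq_star_eq hρ hσ
      (lt_of_le_of_ne ht0 (Ne.symm h0)) (lt_of_le_of_ne ht1 h1) h))
  · rintro (rfl | rfl | h)
    · intro j; rw [star_zero]; ring
    · intro j; rw [star_one]; ring
    · exact h.eigenvalueSeq_star hρ hσ ht0 ht1

/-! ### From ordered eigensystems to ordered eigenbases -/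

lemma HasOrderedEigenbasis.hasOrderedEigensystem (h : HasOrderedEigenbasis ρ σ) :
    HasOrderedEigensystem ρ σ := by
  obtain ⟨φ, hφ⟩ := h
  refine ⟨φ, φ.orthonormal, hφ, fun v hv => ?_⟩
  have : v = 0 := by
    have hs := hasSum_norm_inner_sq φ v
    simp only [hv, norm_zero, ne_eq, OfNat.ofNat_ne_zero, not_false_eq_true, zero_pow] at hs
    simpa using hs.unique hasSum_zero
  simp [this]

lemma hasOrderedEigenbasis_of_forall_eq_zero {φ : DimIndex H → H} (hφ : Orthonormal ℂ φ)
    (heig : ∀ j : DimIndex H,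
      ρ (φ j) = (eigenvalueSeq ρ j : ℂ) • φ j ∧ σ (φ j) = (eigenvalueSeq σ j : ℂ) • φ j)
    (h : ∀ v, (∀ j, ⟪φ j, v⟫_ℂ = 0) → v = 0) : HasOrderedEigenbasis ρ σ := by
  have hsp : (Submodule.span ℂ (Set.range φ))ᗮ = ⊥ := by
    rw [Submodule.eq_bot_iff]
    exact fun v hv => h v (mem_orthogonal_span_range.mp hv)
  refine ⟨HilbertBasis.mkOfOrthogonalEqBot hφ hsp, fun j => ?_⟩
  rw [HilbertBasis.coe_mkOfOrthogonalEqBot]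
  exact heig j

lemma countable_of_orthonormal [TopologicalSpace.SeparableSpace H] {ι : Type*} {φ : ι → H}
    (hφ : Orthonormal ℂ φ) : Countable ι := by
  have hd : (Set.univ : Set ι).PairwiseDisjoint fun i => Metric.ball (φ i) (1 / 2) := by
    intro i _ j _ hij
    refine Metric.ball_disjoint_ball ?_
    rw [dist_eq_norm]
    refine le_of_sq_le_sq ?_ (norm_nonneg _)
    rw [@norm_sub_sq ℂ, hφ.2 hij, hφ.1, hφ.1]
    norm_num
  rw [← Set.countable_univ_iff]
  exact hd.countable_of_isOpen (fun _ _ => Metric.isOpen_ball)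
    fun i _ => ⟨φ i, Metric.mem_ball_self (by norm_num)⟩

lemma finiteDimensional_of_hilbertBasis {ι : Type*} [Finite ι] (b : HilbertBasis ι ℂ H) :
    FiniteDimensional ℂ H := by
  have := Fintype.ofFinite ι
  exact b.toOrthonormalBasis.toBasis.finiteDimensional_of_finite

lemma finite_setOf_eigenvalueSeq_ne_zero {φ : DimIndex H → H} (hφ : Orthonormal ℂ φ)
    (heig : ∀ j : DimIndex H, A (φ j) = (eigenvalueSeq A j : ℂ) • φ j)
    [FiniteDimensional ℂ A.range] : {j : DimIndex H | eigenvalueSeq A j ≠ 0}.Finite := by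
  have hmem : ∀ j : {j : DimIndex H | eigenvalueSeq A j ≠ 0}, φ j ∈ A.range := by
    rintro ⟨j, hj⟩
    have hj' : (eigenvalueSeq A j : ℂ) ≠ 0 := by exact_mod_cast hj
    refine ⟨(eigenvalueSeq A j : ℂ)⁻¹ • φ j, ?_⟩
    change A _ = _
    rw [map_smul, heig, smul_smul, inv_mul_cancel₀ hj', one_smul]
  have hli : LinearIndependent ℂ
      (fun j : {j : DimIndex H | eigenvalueSeq A j ≠ 0} => (⟨φ j, hmem j⟩ : A.range)) :=
    LinearIndependent.of_comp (Submodule.subtype _)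
      (hφ.linearIndependent.comp _ Subtype.val_injective)
  exact Set.finite_coe_iff.mp hli.finite_of_isNoetherian

/-- A density matrix vanishes off those of its eigenvectors that have a nonzero eigenvalue. -/
lemma IsDensity.apply_eq_zero_of_inner_eq_zero (hA : IsDensity A) {φ : DimIndex H → H}
    (hφ : Orthonormal ℂ φ)
    (heig : ∀ j : DimIndex H, A (φ j) = (eigenvalueSeq A j : ℂ) • φ j)
    {J : Set (DimIndex H)} (hJ : ∀ j ∉ J, eigenvalueSeq A j = 0) {v : H}
    (hv : ∀ j ∈ J, ⟪φ j, v⟫_ℂ = 0) : A v = 0 := by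
  refine hA.apply_eq_zero_of_hasSum (hφ.comp ((↑) : J → DimIndex H) Subtype.val_injective) ?_
    fun j => hv j j.2
  have h1 : ∀ j, (⟪φ j, A (φ j)⟫_ℂ).re = eigenvalueSeq A j := fun j =>
    re_inner_apply_eigenvector (hφ.1 j) (heig j)
  simp only [Function.comp_apply, h1]
  refine (Subtype.val_injective.hasSum_iff (f := fun j : DimIndex H => eigenvalueSeq A j)
    fun j hj => hJ j fun h => hj ⟨⟨j, h⟩, rfl⟩).mpr hA.hasSum_eigenvalueSeq_dimIndex

/-- In infinite dimension the family may miss part of the common kernel. Finite rank leaves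
infinitely many indices with both eigenvalues zero. These can be reassigned to a full orthonormal
basis of the complement of the finitely many other vectors, which is countably infinite by
separability. -/
lemma HasOrderedEigensystem.hasOrderedEigenbasis_of_finiteDimensional_range
    [TopologicalSpace.SeparableSpace H] (hρ : IsDensity ρ) (hσ : IsDensity σ)
    [FiniteDimensional ℂ ρ.range] [FiniteDimensional ℂ σ.range]
    (h : HasOrderedEigensystem ρ σ) : HasOrderedEigenbasis ρ σ := by
  classical
  obtain ⟨φ, hφ, heig, -⟩ := h
  rcases lt_or_ge (Module.rank ℂ H) Cardinal.aleph0 with hfin | hinf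
  · exact hasOrderedEigenbasis_of_forall_eq_zero hφ heig
      fun v hv => eq_zero_of_inner_dimIndex_eq_zero hfin hφ hv
  have : Infinite (DimIndex H) :=
    Infinite.of_injective (fun n : ℕ => (⟨n, Cardinal.natCast_lt_aleph0.trans_le hinf⟩ : DimIndex H))
      fun a b hab => congrArg Subtype.val hab
  set J : Set (DimIndex H) := {j | eigenvalueSeq ρ j ≠ 0} ∪ {j | eigenvalueSeq σ j ≠ 0} with hJ
  have hJfin : J.Finite :=
    (finite_setOf_eigenvalueSeq_ne_zero hφ fun j => (heig j).1).union
      (finite_setOf_eigenvalueSeq_ne_zero hφ fun j => (heig j).2)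
  have hJρ : ∀ j ∉ J, eigenvalueSeq ρ j = 0 := fun j hj =>
    by_contra fun h => hj (Or.inl h)
  have hJσ : ∀ j ∉ J, eigenvalueSeq σ j = 0 := fun j hj =>
    by_contra fun h => hj (Or.inr h)
  obtain ⟨w, b, f, hf, hb⟩ :=
    exists_hilbertBasis_extending (hφ.comp ((↑) : J → DimIndex H) Subtype.val_injective)
  have : Infinite w := by
    by_contra hw
    rw [not_infinite_iff_finite] at hw
    have := finiteDimensional_of_hilbertBasis b
    exact absurd (Module.rank_lt_aleph0 ℂ H) (not_lt.mpr hinf)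
  have : Countable w := countable_of_orthonormal b.orthonormal
  have : Finite J := hJfin
  have hJc : Infinite (Jᶜ : Set _) := hJfin.infinite_compl.to_subtype
  have hfc : Infinite ((Set.range f)ᶜ : Set _) := (Set.finite_range f).infinite_compl.to_subtype
  obtain ⟨e⟩ : Nonempty ((Jᶜ : Set _) ≃ ((Set.range f)ᶜ : Set _)) := nonempty_equiv_of_countable
  let g : DimIndex H ≃ w := (Equiv.Set.sumCompl J).symm.trans
    ((Equiv.sumCongr (Equiv.ofInjective f hf) e).trans (Equiv.Set.sumCompl (Set.range f)))
  have hgJ : ∀ j (hj : j ∈ J), g j = f ⟨j, hj⟩ := by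
    intro j hj
    simp only [g, Equiv.trans_apply, Equiv.Set.sumCompl_symm_apply_of_mem hj, Equiv.sumCongr_apply,
      Sum.map_inl, Equiv.Set.sumCompl_apply_inl, Equiv.ofInjective_apply]
  have hgo : Orthonormal ℂ fun j => b (g j) := b.orthonormal.comp g g.injective
  have hgφ : ∀ j ∈ J, b (g j) = φ j := fun j hj => by rw [hgJ j hj, hb]; rfl
  refine hasOrderedEigenbasis_of_forall_eq_zero hgo (fun j => ?_) fun v hv => ?_
  · by_cases hj : j ∈ J
    · rw [hgφ j hj]
      exact heig j
    · have hperp : ∀ i ∈ J, ⟪φ i, b (g j)⟫_ℂ = 0 := by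
        intro i hi
        rw [← hgφ i hi]
        exact hgo.2 fun hij => hj (hij ▸ hi)
      rw [hJρ j hj, hJσ j hj,
        hρ.apply_eq_zero_of_inner_eq_zero hφ (fun j => (heig j).1) hJρ hperp,
        hσ.apply_eq_zero_of_inner_eq_zero hφ (fun j => (heig j).2) hJσ hperp]
      simp
  · have hs := hasSum_norm_inner_sq b v
    have hz : ∀ i, ⟪b i, v⟫_ℂ = 0 := fun i => by simpa using hv (g.symm i)
    simp only [hz, norm_zero, ne_eq, OfNat.ofNat_ne_zero, not_false_eq_true, zero_pow] at hs
    simpa using hs.unique hasSum_zero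

lemma hasOrderedEigensystem_iff_hasOrderedEigenbasis [TopologicalSpace.SeparableSpace H]
    (hρ : IsDensity ρ) (hσ : IsDensity σ)
    (h : ρ.ker ⊓ σ.ker = ⊥ ∨ (FiniteDimensional ℂ ρ.range ∧ FiniteDimensional ℂ σ.range)) :
    HasOrderedEigensystem ρ σ ↔ HasOrderedEigenbasis ρ σ := by
  refine ⟨fun hs => ?_, fun hb => hb.hasOrderedEigensystem⟩
  rcases h with h | ⟨h1, h2⟩
  · obtain ⟨φ, hφ, heig, hzero⟩ := hs
    -- A vector orthogonal to the family lies in both kernels.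
    refine hasOrderedEigenbasis_of_forall_eq_zero hφ heig fun v hv => ?_
    have hmem : v ∈ ρ.ker ⊓ σ.ker := ⟨(hzero v hv).1, (hzero v hv).2⟩
    rwa [h, Submodule.mem_bot] at hmem
  · exact hs.hasOrderedEigenbasis_of_finiteDimensional_range hρ hσ

end

end PartialSwap

end

theorem theorem1 {H : Type*} [NormedAddCommGroup H] [InnerProductSpace ℂ H] [CompleteSpace H]
    [TopologicalSpace.SeparableSpace H] (ρ σ : H →L[ℂ] H)
    (hρ : PartialSwap.IsDensity ρ) (hσ : PartialSwap.IsDensity σ)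
    (t : ℝ) (ht0 : 0 ≤ t) (ht1 : t ≤ 1) :
    PartialSwap.IsDensity (PartialSwap.star t ρ σ) ∧
    PartialSwap.IsMajorizedBy (PartialSwap.eigenvalueSeq (PartialSwap.star t ρ σ))
      (fun j => t * PartialSwap.eigenvalueSeq ρ j + (1 - t) * PartialSwap.eigenvalueSeq σ j) ∧
    ((∀ j, t * PartialSwap.eigenvalueSeq ρ j + (1 - t) * PartialSwap.eigenvalueSeq σ j =
        PartialSwap.eigenvalueSeq (PartialSwap.star t ρ σ) j) ↔
      t = 0 ∨ t = 1 ∨ PartialSwap.HasOrderedEigensystem ρ σ) ∧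
    ((ρ.ker ⊓ σ.ker = ⊥ ∨ (FiniteDimensional ℂ ρ.range ∧ FiniteDimensional ℂ σ.range)) →
      ((∀ j, t * PartialSwap.eigenvalueSeq ρ j + (1 - t) * PartialSwap.eigenvalueSeq σ j =
          PartialSwap.eigenvalueSeq (PartialSwap.star t ρ σ) j) ↔
        t = 0 ∨ t = 1 ∨ PartialSwap.HasOrderedEigenbasis ρ σ)) := by
  refine ⟨hρ.isDensity_star hσ ht0 ht1, PartialSwap.isMajorizedBy_star hρ hσ ht0 ht1,
    PartialSwap.eigenvalueSeq_star_eq_iff hρ hσ ht0 ht1, fun h => ?_⟩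
  rw [PartialSwap.eigenvalueSeq_star_eq_iff hρ hσ ht0 ht1,
    PartialSwap.hasOrderedEigensystem_iff_hasOrderedEigenbasis hρ hσ h]
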